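/- Let $\chi:[0,+\infty)\to\mathbb{R}$ be a compactly supported infinitely smooth function with $\chi=1$ in a neighbourhood of zero. For $s\in(-3,+\infty)$ and $\alpha,\beta\in\{1,2,3\}$ define $f^{(s)}_{\alpha\beta}:\mathbb{R}^3\to\mathbb{R}$ by $f^{(s)}_{\alpha\beta}(0)=0$ and $$f^{(s)}_{\alpha\beta}(y)=\frac{y_\alpha y_\beta-\frac13\delta_{\alpha\beta}|y|^2}{|y|^{2-s}}\,\chi(|y|)\quad\text{for } y\neq 0,$$ which is integrable, and let $$\hat f^{(s)}_{\alpha\beta}(\xi)=\int_{\mathbb{R}^3}e^{-iy\cdot\xi}f^{(s)}_{\alpha\beta}(y)\,dy .$$ Put $c(0)=-6\pi^2$, $c(-2)=-\pi^2$ and $$c(s)=-\frac{4\pi\,\Gamma(s+4)}{s(s+2)}\sin\frac{\pi s}{2}\quad\text{for } s\in(-3,+\infty)\setminus\{0,-2\}.$$ Then $$\hat f^{(s)}_{\alpha\beta}(\xi)=c(s)\,\frac{\xi_\alpha\xi_\beta-\frac13\delta_{\alpha\beta}|\xi|^2}{|\xi|^{5+s}}+O(|\xi|^{-\infty})\quad\text{as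 }|\xi|\to+\infty,$$ where the remainder, together with its partial derivatives in $\xi$ of any order, is uniform in $s$ over any closed bounded interval $[a,b]\subset(-3,+\infty)$. That is, denoting by $r^{(s)}_{\alpha\beta}(\xi)$ the difference of the left-hand side and the first term on the right-hand side, $r^{(s)}_{\alpha\beta}$ is infinitely differentiable on $\mathbb{R}^3\setminus\{0\}$, and for every $[a,b]\subset(-3,+\infty)$ and all integers $k,N\ge0$ there exist $C$ and $R>0$, independent of $s$ and $\xi$, such that every partial derivative of order $k$ of $r^{(s)}_{\alpha\beta}$ is bounded in absolute value by $C|\xi|^{-N}$ for all $s\in[a,b]$ and all $|\xi|\ge R$. -/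

import Mathlib

open scoped ContDiff

noncomputable section

/-- Cut-off functions `χ : [0, +∞) → ℝ`: infinitely smooth up to the endpoint, compactly supported,
and equal to `1` in a neighbourhood of zero. Only the values of `χ` on `[0, +∞)` are constrained
(and only these will be used). -/
structure IsRadialCutoff (χ : ℝ → ℝ) : Prop where
  smooth : ContDiffOn ℝ ∞ χ (Set.Ici 0)
  compact_support : ∃ R : ℝ, ∀ r : ℝ, 0 ≤ r → R ≤ r → χ r = 0
  eq_one_near_zero : ∃ ε : ℝ, 0 < ε ∧ ∀ r : ℝ, 0 ≤ r → r < ε → χ r = 1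

/-- The trace-free quadratic form `y_α y_β - δ_{αβ} |y|² / 3` on Euclidean space `ℝ³`. -/
def tracelessQuad (α β : Fin 3) (y : EuclideanSpace ℝ (Fin 3)) : ℝ :=
  y α * y β - (1 / 3) * (if α = β then 1 else 0) * ‖y‖ ^ 2

/-- The cut-off kernel `f^(s)_{αβ}`, extended by zero to the origin. -/
def refKernel (χ : ℝ → ℝ) (s : ℝ) (α β : Fin 3) (y : EuclideanSpace ℝ (Fin 3)) : ℝ :=
  open Classical in
  if y = 0 then 0 else tracelessQuad α β y / ‖y‖ ^ (2 - s) * χ ‖y‖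

/-- The Fourier transform `∫ exp(-i y·ξ) f^(s)_{αβ}(y) dy`, without factors of `2π`. -/
def refKernelHat (χ : ℝ → ℝ) (s : ℝ) (α β : Fin 3) (ξ : EuclideanSpace ℝ (Fin 3)) : ℂ :=
  ∫ y : EuclideanSpace ℝ (Fin 3),
    Complex.exp (-Complex.I * ((inner ℝ y ξ : ℝ) : ℂ)) * ((refKernel χ s α β y : ℝ) : ℂ)

/-- The constant `c(s)`. -/
def refConst (s : ℝ) : ℝ :=
  open Classical in
  if s = 0 then -6 * Real.pi ^ 2
  else if s = -2 then -Real.pi ^ 2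
  else -(4 * Real.pi * Real.Gamma (s + 4) / (s * (s + 2))) * Real.sin (Real.pi * s / 2)

/-- The remainder: the Fourier transform minus the leading term
`c(s) (ξ_α ξ_β - δ_{αβ} |ξ|² / 3) / |ξ|^(5+s)`. -/
def refRemainder (χ : ℝ → ℝ) (s : ℝ) (α β : Fin 3) (ξ : EuclideanSpace ℝ (Fin 3)) : ℂ :=
  refKernelHat χ s α β ξ - ((refConst s * (tracelessQuad α β ξ / ‖ξ‖ ^ (5 + s)) : ℝ) : ℂ)

end

open MeasureTheory Set Filter Topology
open scoped SchwartzMap FourierTransform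

/-! Write P for the trace-free form, σ = s/2 and x = |y|², so that the kernel is P(y) x^(σ-1) χ. The
power is a superposition of Gaussians: for σ < 1, Euler's integral gives Γ(1-σ) x^(σ-1) = ∫_0^∞
t^(-σ) e^(-tx) dt. The part over (0,1) is smooth in x, so the singularity of the power lies entirely
in the part over (1,∞). Integration by parts carries this to every σ
(`exists_rpow_eq_laplaceOn_add`): x^(σ-1) equals ∫_1^∞ t^(-σ) e^(-tx) dt / Γ(1-σ) plus a smooth
function. After the cut-off, the smooth part and the change made far from the origin are Schwartz
functions of y, bounded uniformly in s; so are their Fourier transforms, by continuity on the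
Schwartz space.

The main part is transformed exactly. P is a solid harmonic, so P times a Gaussian goes to P times a
Gaussian (`fourier_tracelessQuad_mul_gaussian`). Fubini and t ↦ 1/t then turn the integral over
(1,∞) into -(π^(3/2)/4) P(ξ) ∫_0^1 t^(σ+3/2) e^(-t|ξ|²/4) dt
(`fourier_tracelessQuad_mul_laplaceOn`). Completing it to (0,∞) produces a Gamma factor times a
power of |ξ|, which is the leading term by the duplication and reflection formulas (`refConst_eq`).
What was added, an integral over (1,∞), decays exponentially with all derivatives
(`exists_refRemainder_eq`).

Uniformity through the exceptional values of s rests on 1/Γ being entire: no case distinction in s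
survives outside `refConst_eq`. -/

/-- The Laplace-type integral `∫_I t^σ exp(-t x) dt`. -/
noncomputable def laplaceOn (I : Set ℝ) (σ x : ℝ) : ℝ :=
  ∫ t in I, t ^ σ * Real.exp (-(t * x))

/-! ### Incomplete Laplace integrals: derivatives, bounds, recurrence -/

theorem hasDerivAt_laplaceOn {I : Set ℝ} (hI : MeasurableSet I) (hI0 : I ⊆ Ioi 0) {σ x y : ℝ}
    (hyx : y < x) (h0 : IntegrableOn (fun t : ℝ => t ^ σ * Real.exp (-(t * x))) I)
    (h1 : IntegrableOn (fun t : ℝ => t ^ (σ + 1) * Real.exp (-(t * y))) I) :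
    HasDerivAt (laplaceOn I σ) (-laplaceOn I (σ + 1) x) x := by
  have hmeas : ∀ (τ z : ℝ), Measurable (fun t : ℝ => t ^ τ * Real.exp (-(t * z))) := by
    intro τ z; fun_prop
  have key := hasDerivAt_integral_of_dominated_loc_of_deriv_le (μ := volume.restrict I)
    (F := fun x t : ℝ => t ^ σ * Real.exp (-(t * x)))
    (F' := fun x t : ℝ => -(t ^ (σ + 1) * Real.exp (-(t * x))))
    (x₀ := x) (s := Ioi y) (bound := fun t : ℝ => t ^ (σ + 1) * Real.exp (-(t * y)))
    (Ioi_mem_nhds hyx) (Eventually.of_forall fun z => (hmeas σ z).aestronglyMeasurable) h0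
    (hmeas (σ + 1) x).neg.aestronglyMeasurable ?_ h1 ?_
  · have := key.2
    rw [integral_neg] at this
    exact this
  · refine (ae_restrict_iff' hI).2 (Eventually.of_forall fun t ht z hz => ?_)
    have ht0 : 0 < t := hI0 ht
    rw [norm_neg, Real.norm_of_nonneg (by positivity)]
    have : t * y ≤ t * z := mul_le_mul_of_nonneg_left (le_of_lt hz) ht0.le
    gcongr
  · refine (ae_restrict_iff' hI).2 (Eventually.of_forall fun t ht z hz => ?_)
    have ht0 : 0 < t := hI0 ht
    have h : HasDerivAt (fun z : ℝ => -(t * z)) (-t) z := by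
      simpa using ((hasDerivAt_id z).const_mul t).fun_neg
    refine ((h.exp).const_mul (t ^ σ)).congr_deriv ?_
    rw [Real.rpow_add ht0, Real.rpow_one]
    ring

section Smooth

variable {I U : Set ℝ} {σ : ℝ}

theorem contDiffOn_laplaceOn (hI : MeasurableSet I) (hI0 : I ⊆ Ioi 0) (hU : IsOpen U)
    (h : ∀ n : ℕ, ∀ x ∈ U, IntegrableOn (fun t : ℝ => t ^ (σ + n) * Real.exp (-(t * x))) I) :
    ContDiffOn ℝ ∞ (laplaceOn I σ) U := by
  have hd : ∀ (τ : ℝ), (∀ n : ℕ, ∀ x ∈ U,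
      IntegrableOn (fun t : ℝ => t ^ (τ + n) * Real.exp (-(t * x))) I) →
      ∀ x ∈ U, HasDerivAt (laplaceOn I τ) (-laplaceOn I (τ + 1) x) x := by
    intro τ hτ x hx
    -- A point of U to the left of x: exp(-ty) dominates exp(-tz) for all z near x.
    obtain ⟨y, hyx, hyU⟩ : ∃ y, y < x ∧ y ∈ U := by
      have h1 : ∀ᶠ y in 𝓝[<] x, y ∈ U := nhdsWithin_le_nhds (hU.mem_nhds hx)
      obtain ⟨y, h2, h3⟩ := (h1.and self_mem_nhdsWithin).exists
      exact ⟨y, h3, h2⟩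
    exact hasDerivAt_laplaceOn hI hI0 hyx (by simpa using hτ 0 x hx) (by simpa using hτ 1 y hyU)
  rw [contDiffOn_infty]
  intro n
  induction n generalizing σ with
  | zero =>
    simp only [Nat.cast_zero, contDiffOn_zero]
    exact fun x hx => (hd σ h x hx).continuousAt.continuousWithinAt
  | succ n ih =>
    push_cast
    rw [contDiffOn_succ_iff_deriv_of_isOpen hU]
    refine ⟨fun x hx => (hd σ h x hx).differentiableAt.differentiableWithinAt, by simp, ?_⟩
    have h' : ∀ n : ℕ, ∀ x ∈ U,
        IntegrableOn (fun t : ℝ => t ^ (σ + 1 + n) * Real.exp (-(t * x))) I := by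
      intro n x hx
      have := h (n + 1) x hx
      push_cast at this
      rwa [show σ + 1 + (n : ℝ) = σ + (n + 1) by ring]
    exact (ih h').neg.congr fun x hx => (hd σ h x hx).deriv

theorem iteratedDeriv_laplaceOn (hI : MeasurableSet I) (hI0 : I ⊆ Ioi 0) (hU : IsOpen U)
    (h : ∀ n : ℕ, ∀ x ∈ U, IntegrableOn (fun t : ℝ => t ^ (σ + n) * Real.exp (-(t * x))) I)
    (n : ℕ) {x : ℝ} (hx : x ∈ U) :
    iteratedDeriv n (laplaceOn I σ) x = (-1) ^ n * laplaceOn I (σ + n) x := by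
  induction n generalizing x with
  | zero => simp
  | succ n ih =>
    rw [iteratedDeriv_succ]
    obtain ⟨y, hyx, hyU⟩ : ∃ y, y < x ∧ y ∈ U := by
      have h1 : ∀ᶠ y in 𝓝[<] x, y ∈ U := nhdsWithin_le_nhds (hU.mem_nhds hx)
      obtain ⟨y, h2, h3⟩ := (h1.and self_mem_nhdsWithin).exists
      exact ⟨y, h3, h2⟩
    have e : iteratedDeriv n (laplaceOn I σ) =ᶠ[𝓝 x] fun x => (-1) ^ n * laplaceOn I (σ + n) x := by
      filter_upwards [hU.mem_nhds hx] with z hz using ih hz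
    rw [e.deriv_eq]
    have h1 : IntegrableOn (fun t : ℝ => t ^ (σ + n + 1) * Real.exp (-(t * y))) I := by
      have := h (n + 1) y hyU
      push_cast at this
      rwa [add_assoc]
    rw [((hasDerivAt_laplaceOn hI hI0 hyx (h n x hx) h1).const_mul ((-1) ^ n)).deriv]
    push_cast
    rw [← add_assoc]
    ring

end Smooth

theorem integrableOn_Ioi_one_rpow_mul_exp (σ : ℝ) {x : ℝ} (hx : 0 < x) :
    IntegrableOn (fun t : ℝ => t ^ σ * Real.exp (-(t * x))) (Ioi 1) := by
  have h : IntegrableOn (fun t : ℝ => t ^ (max σ 0) * Real.exp (-x * t)) (Ioi 1) := by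
    refine (integrableOn_rpow_mul_exp_neg_mul_rpow (s := max σ 0) (p := 1) (b := x)
      (lt_of_lt_of_le (by norm_num) (le_max_right _ _)) zero_lt_one hx).mono_set
      (Ioi_subset_Ioi zero_le_one) |>.congr_fun (fun t _ => ?_) measurableSet_Ioi
    simp
  refine h.mono' (by fun_prop) ((ae_restrict_iff' measurableSet_Ioi).2
    (Eventually.of_forall fun t ht => ?_))
  have ht1 : (1 : ℝ) < t := ht
  rw [Real.norm_of_nonneg (by positivity), show -(t * x) = -x * t by ring]
  gcongr
  · exact ht1.le
  · exact le_max_left _ _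

theorem integrableOn_Ioo_rpow_mul_exp {σ : ℝ} (hσ : -1 < σ) (x : ℝ) :
    IntegrableOn (fun t : ℝ => t ^ σ * Real.exp (-(t * x))) (Ioo 0 1) := by
  have h : IntegrableOn (fun t : ℝ => t ^ σ * Real.exp |x|) (Ioo 0 1) :=
    (((intervalIntegral.integrableOn_Ioo_rpow_iff zero_lt_one).2 hσ)).mul_const _
  refine h.mono' (by fun_prop) ((ae_restrict_iff' measurableSet_Ioo).2
    (Eventually.of_forall fun t ht => ?_))
  have ht0 : 0 < t := ht.1
  rw [Real.norm_of_nonneg (by positivity)]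
  gcongr
  calc -(t * x) ≤ |t * x| := neg_le_abs _
    _ = t * |x| := by rw [abs_mul, abs_of_pos ht0]
    _ ≤ 1 * |x| := by gcongr; exact ht.2.le
    _ = |x| := one_mul _

theorem laplaceOn_nonneg {I : Set ℝ} (hI : MeasurableSet I) (hI0 : I ⊆ Ioi 0) (σ x : ℝ) :
    0 ≤ laplaceOn I σ x :=
  setIntegral_nonneg hI fun t ht => by
    have : 0 < t := hI0 ht
    positivity

theorem abs_iteratedDeriv_laplaceOn_Ioi_one {σ x : ℝ} (n : ℕ) (hx : 0 < x) :
    |iteratedDeriv n (laplaceOn (Ioi 1) σ) x| = laplaceOn (Ioi 1) (σ + n) x := by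
  have h01 : Ioi (1 : ℝ) ⊆ Ioi 0 := Ioi_subset_Ioi zero_le_one
  rw [iteratedDeriv_laplaceOn measurableSet_Ioi h01 isOpen_Ioi
    (fun n x hx => integrableOn_Ioi_one_rpow_mul_exp _ hx) n hx, abs_mul, abs_pow, abs_neg, abs_one,
    one_pow, one_mul, abs_of_nonneg (laplaceOn_nonneg measurableSet_Ioi h01 _ _)]

theorem contDiffOn_laplaceOn_Ioi_one (σ : ℝ) : ContDiffOn ℝ ∞ (laplaceOn (Ioi 1) σ) (Ioi 0) :=
  contDiffOn_laplaceOn measurableSet_Ioi (Ioi_subset_Ioi zero_le_one) isOpen_Ioi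
    (fun _ _ hx => integrableOn_Ioi_one_rpow_mul_exp _ hx)

theorem exists_pow_mul_exp_neg_half_le (k : ℕ) : ∃ C : ℝ, 0 ≤ C ∧ ∀ x : ℝ, 0 ≤ x →
    x ^ k * Real.exp (-(x / 2)) ≤ C := by
  refine ⟨2 ^ k * k.factorial, by positivity, fun x hx => ?_⟩
  have h := Real.pow_div_factorial_le_exp (x / 2) (by positivity) k
  rw [Real.exp_neg, ← div_eq_mul_inv, div_le_iff₀ (Real.exp_pos _)]
  rw [div_le_iff₀ (by positivity), div_pow, div_le_iff₀ (by positivity)] at h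
  linarith

/-- For t > 1 and x ≥ δ one has tx ≥ x/2 + tδ/2: the first half of the exponent absorbs the power of
x, the second keeps the integral in t convergent. The exponent σ is replaced by its upper bound
because t > 1. -/
theorem exists_pow_mul_iteratedDeriv_laplaceOn_Ioi_one_le (B δ : ℝ) (hδ : 0 < δ) (k n : ℕ) :
    ∃ C : ℝ, ∀ σ ≤ B, ∀ x : ℝ, δ ≤ x →
      |x| ^ k * |iteratedDeriv n (laplaceOn (Ioi 1) σ) x| ≤ C := by
  obtain ⟨C, hC0, hC⟩ := exists_pow_mul_exp_neg_half_le k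
  refine ⟨C * laplaceOn (Ioi 1) (B + n) (δ / 2), fun σ hσ x hx => ?_⟩
  have hx0 : 0 < x := hδ.trans_le hx
  rw [abs_iteratedDeriv_laplaceOn_Ioi_one n hx0, abs_of_pos hx0]
  unfold laplaceOn
  rw [← integral_const_mul, ← integral_const_mul]
  refine setIntegral_mono_on ((integrableOn_Ioi_one_rpow_mul_exp _ hx0).const_mul _)
    ((integrableOn_Ioi_one_rpow_mul_exp _ (half_pos hδ)).const_mul _) measurableSet_Ioi
    fun t ht => ?_
  have ht1 : (1 : ℝ) < t := ht
  have ht0 : 0 < t := by linarith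
  have h1 : t ^ (σ + n) ≤ t ^ (B + n) := Real.rpow_le_rpow_of_exponent_le ht1.le (by linarith)
  have h2 : Real.exp (-(t * x)) ≤ Real.exp (-(x / 2)) * Real.exp (-(t * (δ / 2))) := by
    rw [← Real.exp_add]
    apply Real.exp_le_exp.2
    nlinarith [mul_le_mul_of_nonneg_left hx ht0.le, mul_le_mul_of_nonneg_right ht1.le hx0.le]
  calc x ^ k * (t ^ (σ + n) * Real.exp (-(t * x)))
      ≤ x ^ k * (t ^ (B + n) * (Real.exp (-(x / 2)) * Real.exp (-(t * (δ / 2))))) := by gcongr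
    _ = (x ^ k * Real.exp (-(x / 2))) * (t ^ (B + n) * Real.exp (-(t * (δ / 2)))) := by ring
    _ ≤ C * (t ^ (B + n) * Real.exp (-(t * (δ / 2)))) := by
        gcongr
        exact hC x hx0.le

/-- Since t < 1, powers of t grow as the exponent falls, so the lowest exponent A dominates all σ
and all derivatives at once. -/
theorem exists_iteratedDeriv_laplaceOn_Ioo_le (A : ℝ) (hA : -1 < A) (X : ℝ) (n : ℕ) :
    ∃ C : ℝ, ∀ σ, A ≤ σ → ∀ x : ℝ, |x| ≤ X →
      |iteratedDeriv n (laplaceOn (Ioo 0 1) σ) x| ≤ C := by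
  have h0 : Ioo (0 : ℝ) 1 ⊆ Ioi 0 := fun t ht => ht.1
  refine ⟨laplaceOn (Ioo 0 1) A (-X), fun σ hσ x hx => ?_⟩
  rw [iteratedDeriv_laplaceOn (U := univ) measurableSet_Ioo h0 isOpen_univ
    (fun n x _ => integrableOn_Ioo_rpow_mul_exp
      (by have : (0 : ℝ) ≤ n := n.cast_nonneg
          linarith) x) n (mem_univ x), abs_mul, abs_pow, abs_neg,
    abs_one, one_pow, one_mul, abs_of_nonneg (laplaceOn_nonneg measurableSet_Ioo h0 _ _)]
  have hn : (0 : ℝ) ≤ n := n.cast_nonneg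
  refine setIntegral_mono_on (integrableOn_Ioo_rpow_mul_exp (by linarith) x)
    (integrableOn_Ioo_rpow_mul_exp hA _) measurableSet_Ioo fun t ht => ?_
  have ht0 : 0 < t := ht.1
  have h1 : t ^ (σ + n) ≤ t ^ A := Real.rpow_le_rpow_of_exponent_ge ht0 ht.2.le (by linarith)
  have h2 : Real.exp (-(t * x)) ≤ Real.exp (-(t * -X)) := by
    apply Real.exp_le_exp.2
    nlinarith [neg_abs_le x]
  gcongr

theorem contDiff_laplaceOn_Ioo {σ : ℝ} (hσ : -1 < σ) : ContDiff ℝ ∞ (laplaceOn (Ioo 0 1) σ) := by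
  rw [← contDiffOn_univ]
  exact contDiffOn_laplaceOn measurableSet_Ioo (fun t ht => ht.1) isOpen_univ
    (fun n x _ => integrableOn_Ioo_rpow_mul_exp
      (by have : (0 : ℝ) ≤ n := n.cast_nonneg
          linarith) x)

/-- Splitting Euler's integral at `t = 1`. -/
theorem laplaceOn_Ioo_add_laplaceOn_Ioi {σ x : ℝ} (hσ : -1 < σ) (hx : 0 < x) :
    laplaceOn (Ioo 0 1) σ x + laplaceOn (Ioi 1) σ x = Real.Gamma (σ + 1) * x ^ (-σ - 1) := by
  have h := Real.integral_rpow_mul_exp_neg_mul_Ioi (a := σ + 1) (by linarith) hx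
  rw [add_sub_cancel_right, ← Ioc_union_Ioi_eq_Ioi zero_le_one, setIntegral_union
    (Ioc_disjoint_Ioi le_rfl) measurableSet_Ioi, integral_Ioc_eq_integral_Ioo] at h
  · unfold laplaceOn
    simp_rw [mul_comm _ x]
    rw [h, one_div, Real.inv_rpow hx.le, ← Real.rpow_neg hx.le, mul_comm]
    congr 2
    ring
  · rw [integrableOn_Ioc_iff_integrableOn_Ioo]
    simpa only [mul_comm _ x] using integrableOn_Ioo_rpow_mul_exp hσ x
  · simpa only [mul_comm _ x] using integrableOn_Ioi_one_rpow_mul_exp σ hx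

/-- Integration by parts for the upper incomplete integral. -/
theorem mul_laplaceOn_Ioi_one (σ : ℝ) {x : ℝ} (hx : 0 < x) :
    x * laplaceOn (Ioi 1) σ x = Real.exp (-x) + σ * laplaceOn (Ioi 1) (σ - 1) x := by
  have hint := ((integrableOn_Ioi_one_rpow_mul_exp (σ - 1) hx).const_mul σ).sub
    ((integrableOn_Ioi_one_rpow_mul_exp σ hx).const_mul x)
  have key := integral_Ioi_of_hasDerivAt_of_tendsto' (a := (1 : ℝ))
    (f := fun t : ℝ => t ^ σ * Real.exp (-(t * x))) (m := 0)
    (f' := fun t : ℝ => σ * (t ^ (σ - 1) * Real.exp (-(t * x))) -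
      x * (t ^ σ * Real.exp (-(t * x)))) ?_ hint ?_
  · rw [integral_sub ((integrableOn_Ioi_one_rpow_mul_exp (σ - 1) hx).const_mul σ)
      ((integrableOn_Ioi_one_rpow_mul_exp σ hx).const_mul x), integral_const_mul,
      integral_const_mul] at key
    simp only [Real.one_rpow, one_mul] at key
    unfold laplaceOn
    linarith
  · intro t ht
    have ht0 : 0 < t := lt_of_lt_of_le zero_lt_one ht
    have h : HasDerivAt (fun t : ℝ => -(t * x)) (-x) t := by
      simpa using ((hasDerivAt_id t).mul_const x).fun_neg
    refine ((Real.hasDerivAt_rpow_const (p := σ) (Or.inl ht0.ne')).fun_mul h.exp).congr_deriv ?_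
    ring
  · have := tendsto_rpow_mul_exp_neg_mul_atTop_nhds_zero σ x hx
    refine this.congr fun t => ?_
    ring_nf

/-! ### Families of smooth functions, locally bounded uniformly in a parameter -/

/-- Every derivative of `F σ` is bounded on bounded sets, uniformly for `σ ∈ S`. -/
structure UniformlySmooth (S : Set ℝ) (F : ℝ → ℝ → ℝ) : Prop where
  contDiff : ∀ σ ∈ S, ContDiff ℝ ∞ (F σ)
  bound : ∀ (n : ℕ) (X : ℝ), ∃ C : ℝ, ∀ σ ∈ S, ∀ x : ℝ, |x| ≤ X → |iteratedDeriv n (F σ) x| ≤ C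

theorem ContDiff.uniformlySmooth {f : ℝ → ℝ} (hf : ContDiff ℝ ∞ f) (S : Set ℝ) :
    UniformlySmooth S (fun _ => f) where
  contDiff := fun _ _ => hf
  bound := fun n X => by
    obtain ⟨C, hC⟩ := (isCompact_Icc (a := -X) (b := X)).exists_bound_of_continuousOn
      (hf.continuous_iteratedDeriv n (by exact_mod_cast le_top)).continuousOn
    exact ⟨C, fun σ _ x hx => hC x (abs_le.1 hx)⟩

theorem uniformlySmooth_const {S : Set ℝ} {c : ℝ → ℝ} {M : ℝ} (hM : ∀ σ ∈ S, |c σ| ≤ M) :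
    UniformlySmooth S (fun σ _ => c σ) where
  contDiff := fun _ _ => contDiff_const
  bound := fun n X => by
    refine ⟨max M 0, fun σ hσ x _ => ?_⟩
    rw [iteratedDeriv_const]
    split_ifs
    · exact (hM σ hσ).trans (le_max_left _ _)
    · simp

theorem UniformlySmooth.add {S : Set ℝ} {F G : ℝ → ℝ → ℝ} (hF : UniformlySmooth S F)
    (hG : UniformlySmooth S G) : UniformlySmooth S (fun σ x => F σ x + G σ x) where
  contDiff := fun σ hσ => (hF.contDiff σ hσ).add (hG.contDiff σ hσ)
  bound := fun n X => by
    obtain ⟨C, hC⟩ := hF.bound n X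
    obtain ⟨D, hD⟩ := hG.bound n X
    refine ⟨C + D, fun σ hσ x hx => ?_⟩
    rw [iteratedDeriv_fun_add ((hF.contDiff σ hσ).contDiffAt.of_le (by exact_mod_cast le_top))
      ((hG.contDiff σ hσ).contDiffAt.of_le (by exact_mod_cast le_top))]
    exact (abs_add_le _ _).trans (add_le_add (hC σ hσ x hx) (hD σ hσ x hx))

/-- A Leibniz bound for iterated derivatives on an open set. -/
theorem abs_iteratedDeriv_mul_le {f g : ℝ → ℝ} {U : Set ℝ} (hU : IsOpen U)
    (hf : ContDiffOn ℝ ∞ f U) (hg : ContDiffOn ℝ ∞ g U) {x : ℝ} (hx : x ∈ U) (n : ℕ) :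
    |iteratedDeriv n (fun y => f y * g y) x| ≤ ∑ i ∈ Finset.range (n + 1),
      (n.choose i : ℝ) * |iteratedDeriv i f x| * |iteratedDeriv (n - i) g x| := by
  have h := norm_iteratedFDerivWithin_mul_le (N := ∞) hf hg hU.uniqueDiffOn hx (n := n)
    (by exact_mod_cast le_top)
  simpa only [iteratedFDerivWithin_of_isOpen _ hU hx, norm_iteratedFDeriv_eq_norm_iteratedDeriv,
    Real.norm_eq_abs] using h

theorem UniformlySmooth.mul {S : Set ℝ} {F G : ℝ → ℝ → ℝ} (hF : UniformlySmooth S F)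
    (hG : UniformlySmooth S G) : UniformlySmooth S (fun σ x => F σ x * G σ x) where
  contDiff := fun σ hσ => (hF.contDiff σ hσ).mul (hG.contDiff σ hσ)
  bound := fun n X => by
    choose C hC using fun n => hF.bound n X
    choose D hD using fun n => hG.bound n X
    refine ⟨∑ i ∈ Finset.range (n + 1), (n.choose i : ℝ) * C i * D (n - i),
      fun σ hσ x hx => ?_⟩
    refine (abs_iteratedDeriv_mul_le isOpen_univ (hF.contDiff σ hσ).contDiffOn
      (hG.contDiff σ hσ).contDiffOn (mem_univ x) n).trans (Finset.sum_le_sum fun i _ => ?_)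
    have h0 := (abs_nonneg _).trans (hC i σ hσ x hx)
    gcongr
    · exact hC i σ hσ x hx
    · exact hD _ σ hσ x hx

/-- Shifting the parameter. -/
theorem UniformlySmooth.comp_param {S T : Set ℝ} {F : ℝ → ℝ → ℝ} (hF : UniformlySmooth S F)
    {u : ℝ → ℝ} (hu : MapsTo u T S) : UniformlySmooth T (fun σ => F (u σ)) where
  contDiff := fun σ hσ => hF.contDiff _ (hu hσ)
  bound := fun n X => by
    obtain ⟨C, hC⟩ := hF.bound n X
    exact ⟨C, fun σ hσ => hC _ (hu hσ)⟩

/-! ### The reciprocal Gamma function and the decomposition of powers -/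

theorem continuous_inv_Gamma : Continuous fun s : ℝ => (Real.Gamma s)⁻¹ := by
  have h : Continuous fun s : ℝ => ((Complex.Gamma (s : ℂ))⁻¹).re :=
    Complex.continuous_re.comp
      (Complex.differentiable_one_div_Gamma.continuous.comp Complex.continuous_ofReal)
  refine h.congr fun s => ?_
  rw [Complex.Gamma_ofReal, ← Complex.ofReal_inv, Complex.ofReal_re]

theorem exists_abs_inv_Gamma_one_sub_le (A B : ℝ) :
    ∃ M : ℝ, ∀ σ ∈ Icc A B, |(Real.Gamma (1 - σ))⁻¹| ≤ M :=
  (isCompact_Icc (a := A) (b := B)).exists_bound_of_continuousOn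
    (continuous_inv_Gamma.comp (continuous_const.sub continuous_id)).continuousOn

/-- True at the poles as well: there `Real.Gamma` has the default value 0, whose inverse 0 is the
value of the entire function 1/Γ. -/
theorem mul_inv_Gamma_add_one (s : ℝ) : s * (Real.Gamma (s + 1))⁻¹ = (Real.Gamma s)⁻¹ := by
  rcases eq_or_ne s 0 with rfl | hs
  · simp [Real.Gamma_zero]
  · rw [Real.Gamma_add_one hs, mul_inv, mul_inv_cancel_left₀ hs]

/-- Up to a family of smooth functions, the power `x ^ (σ - 1)` is an upper incomplete
Laplace-type integral. -/
theorem exists_rpow_eq_laplaceOn_add (n : ℕ) (A B : ℝ) (hB : B < n + 1) :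
    ∃ G : ℝ → ℝ → ℝ, UniformlySmooth (Icc A B) G ∧ ∀ σ ∈ Icc A B, ∀ x : ℝ, 0 < x →
      x ^ (σ - 1) = (Real.Gamma (1 - σ))⁻¹ * laplaceOn (Ioi 1) (-σ) x + G σ x := by
  induction n generalizing A B with
  | zero =>
    obtain ⟨M, hM⟩ := exists_abs_inv_Gamma_one_sub_le A B
    -- Here σ < 1, and the smooth part is the (0,1) piece of Euler's integral.
    refine ⟨fun σ x => (Real.Gamma (1 - σ))⁻¹ * laplaceOn (Ioo 0 1) (-σ) x,
      (uniformlySmooth_const hM).mul ⟨?_, ?_⟩, ?_⟩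
    · intro σ hσ
      simp only [CharP.cast_eq_zero, zero_add] at hB
      exact contDiff_laplaceOn_Ioo (by linarith [hσ.2])
    · intro n X
      simp only [CharP.cast_eq_zero, zero_add] at hB
      obtain ⟨C, hC⟩ := exists_iteratedDeriv_laplaceOn_Ioo_le (-B) (by linarith) X n
      exact ⟨C, fun σ hσ x hx => hC _ (by linarith [hσ.2]) x hx⟩
    · intro σ hσ x hx
      simp only [CharP.cast_eq_zero, zero_add] at hB
      have h := laplaceOn_Ioo_add_laplaceOn_Ioi (σ := -σ) (by linarith [hσ.2]) hx
      have hΓ : Real.Gamma (1 - σ) ≠ 0 := (Real.Gamma_pos_of_pos (by linarith [hσ.2])).ne'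
      rw [show -σ + 1 = 1 - σ by ring, neg_neg] at h
      rw [← mul_add, add_comm (laplaceOn _ _ _), h, inv_mul_cancel_left₀ hΓ]
  | succ n ih =>
    obtain ⟨G, hG, hG'⟩ := ih (A - 1) (B - 1) (by push_cast at hB; linarith)
    obtain ⟨M, hM⟩ := exists_abs_inv_Gamma_one_sub_le (A - 1) (B - 1)
    have hmap : MapsTo (fun σ : ℝ => σ - 1) (Icc A B) (Icc (A - 1) (B - 1)) :=
      fun σ hσ => ⟨by linarith [hσ.1], by linarith [hσ.2]⟩
    -- Multiply the formula for σ - 1 by x and integrate by parts: exp(-x) is the boundary term, and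
    -- (1-σ)/Γ(2-σ) = 1/Γ(1-σ) restores the coefficient.
    refine ⟨fun σ x => (Real.Gamma (1 - (σ - 1)))⁻¹ * Real.exp (-x) + x * G (σ - 1) x,
      ((uniformlySmooth_const fun σ hσ => hM (σ - 1) (hmap hσ)).mul
        ((Real.contDiff_exp.comp contDiff_neg).uniformlySmooth _)).add
        ((contDiff_id.uniformlySmooth _).mul (hG.comp_param hmap)), fun σ hσ x hx => ?_⟩
    have h := hG' (σ - 1) (hmap hσ) x hx
    have h2 := mul_laplaceOn_Ioi_one (-(σ - 1)) hx
    have h3 := mul_inv_Gamma_add_one (1 - σ)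
    rw [show 1 - σ + 1 = 1 - (σ - 1) by ring] at h3
    have h4 : x ^ (σ - 1) = x * x ^ (σ - 1 - 1) := by
      rw [Real.rpow_sub_one hx.ne' (σ - 1), mul_div_cancel₀ _ hx.ne']
    rw [show -(σ - 1) - 1 = -σ by ring] at h2
    rw [h4, h, ← h3]
    linear_combination (Real.Gamma (1 - (σ - 1)))⁻¹ * h2

/-! ### Bounded families of Schwartz functions -/

section Bounded

variable {ι E F E' F' : Type*} [NormedAddCommGroup E] [NormedSpace ℝ E] [NormedAddCommGroup F]
  [NormedSpace ℝ F] [NormedAddCommGroup E'] [NormedSpace ℝ E'] [NormedAddCommGroup F']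
  [NormedSpace ℝ F']

/-- The family `Φ s`, `s ∈ S`, is bounded in the Schwartz space. -/
def SchwartzBounded (S : Set ι) (Φ : ι → 𝓢(E, F)) : Prop :=
  ∀ k n : ℕ, ∃ C : ℝ, ∀ s ∈ S, SchwartzMap.seminorm ℝ k n (Φ s) ≤ C

/-- By continuity, each seminorm of T Φ is at most a constant times a finite supremum of seminorms
of Φ. -/
theorem SchwartzBounded.map {S : Set ι} {Φ : ι → 𝓢(E, F)} (h : SchwartzBounded S Φ)
    (T : 𝓢(E, F) →L[ℝ] 𝓢(E', F')) : SchwartzBounded S (fun s => T (Φ s)) := by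
  intro k n
  have hc : Continuous ((SchwartzMap.seminorm ℝ k n (E := E') (F := F')).comp T.toLinearMap) :=
    ((schwartz_withSeminorms ℝ E' F').continuous_seminorm (k, n)).comp T.continuous
  obtain ⟨s, C, _, hle⟩ := Seminorm.bound_of_continuous (schwartz_withSeminorms ℝ E F) _ hc
  choose D hD using h
  refine ⟨C * ∑ p ∈ s, |D p.1 p.2|, fun i hi => (hle (Φ i)).trans ?_⟩
  refine mul_le_mul_of_nonneg_left ?_ C.coe_nonneg
  refine Seminorm.finset_sup_apply_le (Finset.sum_nonneg fun p _ => abs_nonneg _) fun p hp => ?_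
  exact ((hD p.1 p.2 i hi).trans (le_abs_self _)).trans
    (Finset.single_le_sum (f := fun p : ℕ × ℕ => |D p.1 p.2|) (fun p _ => abs_nonneg _) hp)

theorem SchwartzBounded.add {S : Set ι} {Φ Ψ : ι → 𝓢(E, F)} (h : SchwartzBounded S Φ)
    (h' : SchwartzBounded S Ψ) : SchwartzBounded S (fun s => Φ s + Ψ s) := by
  intro k n
  obtain ⟨C, hC⟩ := h k n
  obtain ⟨D, hD⟩ := h' k n
  exact ⟨C + D, fun s hs => (map_add_le_add _ _ _).trans (add_le_add (hC s hs) (hD s hs))⟩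

theorem SchwartzBounded.smul {S : Set ι} {Φ : ι → 𝓢(E, F)} (h : SchwartzBounded S Φ)
    {c : ι → ℝ} {M : ℝ} (hM : ∀ s ∈ S, |c s| ≤ M) : SchwartzBounded S (fun s => c s • Φ s) := by
  intro k n
  obtain ⟨C, hC⟩ := h k n
  refine ⟨M * C, fun s hs => ?_⟩
  rw [map_smul_eq_mul, Real.norm_eq_abs]
  exact mul_le_mul (hM s hs) (hC s hs) (apply_nonneg _ _) ((abs_nonneg _).trans (hM s hs))

end Bounded

/-- A cut-off supported where a family of functions is smooth with rapidly decreasing derivatives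
turns it into a bounded family of Schwartz functions. -/
theorem exists_schwartzBounded_cutoff_mul {S : Set ℝ} {θ : ℝ → ℝ} (hθ : ContDiff ℝ ∞ θ)
    (hθb : ∀ n, ∃ C, ∀ x, |iteratedDeriv n θ x| ≤ C) {U : Set ℝ} (hU : IsOpen U)
    (hsupp : tsupport θ ⊆ U) {G : ℝ → ℝ → ℝ} (hG : ∀ σ ∈ S, ContDiffOn ℝ ∞ (G σ) U)
    (hGb : ∀ k n : ℕ, ∃ C : ℝ, ∀ σ ∈ S, ∀ x ∈ tsupport θ,
      |x| ^ k * |iteratedDeriv n (G σ) x| ≤ C) :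
    ∃ Φ : ℝ → 𝓢(ℝ, ℂ), SchwartzBounded S Φ ∧
      ∀ σ ∈ S, ∀ x, Φ σ x = ((θ x * G σ x : ℝ) : ℂ) := by
  classical
  have hzero : ∀ (σ x : ℝ), x ∉ tsupport θ → (fun y => θ y * G σ y) =ᶠ[𝓝 x] fun _ => 0 := by
    intro σ x hx
    have := notMem_tsupport_iff_eventuallyEq.1 hx
    filter_upwards [this] with y hy
    simp [hy]
  have hsm : ∀ σ ∈ S, ContDiff ℝ ∞ fun x => θ x * G σ x := by
    intro σ hσ
    rw [contDiff_iff_contDiffAt]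
    intro x
    by_cases hx : x ∈ tsupport θ
    · exact hθ.contDiffAt.mul ((hG σ hσ).contDiffAt (hU.mem_nhds (hsupp hx)))
    · exact contDiffAt_const.congr_of_eventuallyEq (hzero σ x hx)
  have hbd : ∀ k n : ℕ, ∃ C : ℝ, 0 ≤ C ∧ ∀ σ ∈ S, ∀ x,
      ‖x‖ ^ k * ‖iteratedFDeriv ℝ n (fun x => θ x * G σ x) x‖ ≤ C := by
    intro k n
    choose C hC using hθb
    choose D hD using hGb k
    refine ⟨max (∑ i ∈ Finset.range (n + 1), (n.choose i : ℝ) * C i * D (n - i)) 0,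
      le_max_right _ _, fun σ hσ x => ?_⟩
    rw [norm_iteratedFDeriv_eq_norm_iteratedDeriv, Real.norm_eq_abs, Real.norm_eq_abs]
    by_cases hx : x ∈ tsupport θ
    · refine le_trans ?_ (le_max_left _ _)
      have h1 := abs_iteratedDeriv_mul_le hU hθ.contDiffOn (hG σ hσ) (hsupp hx) n
      refine (mul_le_mul_of_nonneg_left h1 (by positivity)).trans ?_
      rw [Finset.mul_sum]
      refine Finset.sum_le_sum fun i _ => ?_
      have h0 := (abs_nonneg _).trans (hC i x)
      calc |x| ^ k * ((n.choose i : ℝ) * |iteratedDeriv i θ x| * |iteratedDeriv (n - i) (G σ) x|)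
          = (n.choose i : ℝ) * |iteratedDeriv i θ x| *
            (|x| ^ k * |iteratedDeriv (n - i) (G σ) x|) := by ring
        _ ≤ (n.choose i : ℝ) * C i * D (n - i) := by
          gcongr
          · exact hC i x
          · exact hD _ σ hσ x hx
    · refine le_trans (le_of_eq ?_) (le_max_right _ _)
      rw [(hzero σ x hx).iteratedDeriv_eq n]
      simp
  let Φ : ℝ → 𝓢(ℝ, ℝ) := fun σ => if hσ : σ ∈ S then
    ⟨fun x => θ x * G σ x, hsm σ hσ, fun k n => by
      obtain ⟨C, _, hC⟩ := hbd k n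
      exact ⟨C, hC σ hσ⟩⟩ else 0
  have hΦ : ∀ σ ∈ S, ⇑(Φ σ) = fun x => θ x * G σ x := by
    intro σ hσ
    simp only [Φ, dif_pos hσ]
    rfl
  refine ⟨fun σ => SchwartzMap.postcompCLM (𝕜 := ℝ) Complex.ofRealCLM (Φ σ),
    SchwartzBounded.map (fun k n => ?_) _, fun σ hσ x => ?_⟩
  · obtain ⟨C, hC0, hC⟩ := hbd k n
    refine ⟨C, fun σ hσ => SchwartzMap.seminorm_le_bound ℝ k n _ hC0 fun x => ?_⟩
    rw [hΦ σ hσ]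
    exact hC σ hσ x
  · have := congrFun (hΦ σ hσ) x
    simp [this]

/-! ### Radial lifts and the Fourier transform on Schwartz functions -/

/-- Euclidean three-space. -/
abbrev E3 : Type := EuclideanSpace ℝ (Fin 3)

theorem tracelessQuad_hasTemperateGrowth (α β : Fin 3) :
    (tracelessQuad α β).HasTemperateGrowth := by
  have h : ∀ γ : Fin 3, Function.HasTemperateGrowth (fun y : E3 => y γ) := fun γ =>
    (EuclideanSpace.proj γ : E3 →L[ℝ] ℝ).hasTemperateGrowth
  exact ((h α).mul (h β)).sub
    ((Function.HasTemperateGrowth.const _).mul (Function.hasTemperateGrowth_norm_sq E3))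

theorem contDiff_tracelessQuad (α β : Fin 3) : ContDiff ℝ ∞ (tracelessQuad α β) :=
  (tracelessQuad_hasTemperateGrowth α β).1

/-- Multiplication of a radial function by the trace-free quadratic form. -/
theorem exists_radialLift (α β : Fin 3) {c : ℝ} (hc : 0 < c) :
    ∃ T : 𝓢(ℝ, ℂ) →L[ℝ] 𝓢(E3, ℂ),
      ∀ φ y, T φ y = (tracelessQuad α β y : ℂ) * φ (c * ‖y‖ ^ 2) := by
  have hg : Function.HasTemperateGrowth (fun y : E3 => c * ‖y‖ ^ 2) :=
    (Function.HasTemperateGrowth.const c).mul (Function.hasTemperateGrowth_norm_sq E3)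
  refine ⟨(SchwartzMap.smulLeftCLM ℂ (tracelessQuad α β)).comp
    (SchwartzMap.compCLM ℝ hg ⟨1, 1 + c⁻¹, fun y => ?_⟩), fun φ y => ?_⟩
  · rw [pow_one, Real.norm_of_nonneg (by positivity)]
    have h1 : (1 + c⁻¹) * (1 + c * ‖y‖ ^ 2) = 1 + c⁻¹ + c * ‖y‖ ^ 2 + ‖y‖ ^ 2 := by
      field_simp
      ring
    rw [h1]
    have : 0 < c⁻¹ := by positivity
    have : 0 ≤ c * ‖y‖ ^ 2 := by positivity
    nlinarith [sq_nonneg (‖y‖ - 1)]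
  · rw [ContinuousLinearMap.comp_apply,
      SchwartzMap.smulLeftCLM_apply_apply (tracelessQuad_hasTemperateGrowth α β)]
    rw [Complex.real_smul]
    rfl

/-- The Fourier transform `∫ exp(-i y·ξ) f(y) dy` on Schwartz functions. -/
theorem exists_fourier_exp_neg_inner :
    ∃ T : 𝓢(E3, ℂ) →L[ℝ] 𝓢(E3, ℂ), ∀ f ξ,
      T f ξ = ∫ y : E3, Complex.exp (-Complex.I * ((inner ℝ y ξ : ℝ) : ℂ)) * f y := by
  have h2 : (2 * Real.pi)⁻¹ ≠ 0 := by positivity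
  -- Mathlib's transform has the phase exp(-2πi y·ξ); dilating ξ by 1/(2π) removes the 2π.
  let e : E3 ≃L[ℝ] E3 := ContinuousLinearEquiv.smulLeft (Units.mk0 _ h2)
  refine ⟨(SchwartzMap.compCLMOfContinuousLinearEquiv ℝ e).comp
    (FourierTransform.fourierCLM ℝ 𝓢(E3, ℂ)), fun f ξ => ?_⟩
  have : e ξ = (2 * Real.pi)⁻¹ • ξ := rfl
  simp only [ContinuousLinearMap.comp_apply, SchwartzMap.compCLMOfContinuousLinearEquiv_apply,
    Function.comp_apply, FourierTransform.fourierCLM_apply, SchwartzMap.fourier_coe, this]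
  rw [Real.fourier_eq']
  refine integral_congr_ae (Eventually.of_forall fun y => ?_)
  simp only [inner_smul_right, smul_eq_mul]
  congr 2
  push_cast
  field_simp

/-! ### Fourier transforms of Gaussians times quadratic polynomials -/

theorem integrable_exp_neg_mul_norm_sq {t : ℝ} (ht : 0 < t) :
    Integrable (fun y : E3 => Real.exp (-(t * ‖y‖ ^ 2))) := by
  refine Integrable.of_integral_ne_zero ?_
  simp_rw [← neg_mul]
  rw [GaussianFourier.integral_rexp_neg_mul_sq_norm ht]
  positivity

/-- Half of the exponent pays for ‖y‖², through 1 + u ≤ exp u at u = t‖y‖²/2. -/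
theorem norm_sq_mul_exp_neg_le {t : ℝ} (ht : 0 < t) (y : E3) :
    ‖y‖ ^ 2 * Real.exp (-(t * ‖y‖ ^ 2)) ≤ 2 / t * Real.exp (-(t / 2 * ‖y‖ ^ 2)) := by
  have h := Real.add_one_le_exp (t / 2 * ‖y‖ ^ 2)
  have h2 : Real.exp (-(t * ‖y‖ ^ 2)) =
      Real.exp (-(t / 2 * ‖y‖ ^ 2)) * (Real.exp (t / 2 * ‖y‖ ^ 2))⁻¹ := by
    rw [← Real.exp_neg, ← Real.exp_add]
    ring_nf
  rw [h2, mul_comm (Real.exp _), ← mul_assoc]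
  gcongr
  rw [← div_eq_mul_inv, div_le_div_iff₀ (Real.exp_pos _) ht]
  linarith

theorem integrable_norm_sq_mul_exp {t : ℝ} (ht : 0 < t) :
    Integrable (fun y : E3 => ‖y‖ ^ 2 * Real.exp (-(t * ‖y‖ ^ 2))) := by
  refine ((integrable_exp_neg_mul_norm_sq (half_pos ht)).const_mul (2 / t)).mono'
    (by fun_prop) (Eventually.of_forall fun y => ?_)
  rw [Real.norm_of_nonneg (by positivity)]
  exact norm_sq_mul_exp_neg_le ht y

theorem integrable_mul_gaussian {t : ℝ} (ht : 0 < t) {p : E3 → ℝ} (hp : Continuous p) {C : ℝ}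
    (hpb : ∀ y, |p y| ≤ C * (1 + ‖y‖ ^ 2)) :
    Integrable (fun y : E3 => ((p y * Real.exp (-(t * ‖y‖ ^ 2)) : ℝ) : ℂ)) := by
  suffices h : Integrable (fun y : E3 => p y * Real.exp (-(t * ‖y‖ ^ 2))) from h.ofReal
  refine (((integrable_exp_neg_mul_norm_sq ht).add (integrable_norm_sq_mul_exp ht)).const_mul
    C).mono' (by fun_prop) (Eventually.of_forall fun y => ?_)
  rw [norm_mul, Real.norm_eq_abs, Real.norm_of_nonneg (Real.exp_pos _).le]
  calc |p y| * Real.exp (-(t * ‖y‖ ^ 2)) ≤ C * (1 + ‖y‖ ^ 2) * Real.exp (-(t * ‖y‖ ^ 2)) := by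
        gcongr
        exact hpb y
    _ = _ := by simp only [Pi.add_apply]; ring

theorem norm_exp_neg_I_mul (r : ℝ) : ‖Complex.exp (-Complex.I * (r : ℂ))‖ = 1 := by
  rw [show -Complex.I * (r : ℂ) = ((-r : ℝ) : ℂ) * Complex.I by push_cast; ring,
    Complex.norm_exp_ofReal_mul_I]

/-- Differentiating a Fourier integral in the direction `v`. -/
theorem hasDerivAt_fourier_integral {g : E3 → ℂ} (hg : Integrable g) (v ξ : E3)
    (hg' : Integrable fun y : E3 => ((inner ℝ y v : ℝ) : ℂ) * g y) :
    HasDerivAt (fun τ : ℝ => ∫ y : E3,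
        Complex.exp (-Complex.I * ((inner ℝ y (ξ + τ • v) : ℝ) : ℂ)) * g y)
      (-Complex.I * ∫ y : E3, Complex.exp (-Complex.I * ((inner ℝ y ξ : ℝ) : ℂ)) *
        (((inner ℝ y v : ℝ) : ℂ) * g y)) 0 := by
  have hm : ∀ η : E3, Continuous fun y : E3 =>
      Complex.exp (-Complex.I * ((inner ℝ y η : ℝ) : ℂ)) := fun η => by fun_prop
  have key := hasDerivAt_integral_of_dominated_loc_of_deriv_le (μ := (volume : Measure E3))
    (F := fun (τ : ℝ) (y : E3) =>
      Complex.exp (-Complex.I * ((inner ℝ y (ξ + τ • v) : ℝ) : ℂ)) * g y)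
    (F' := fun (τ : ℝ) (y : E3) => Complex.exp (-Complex.I * ((inner ℝ y (ξ + τ • v) : ℝ) : ℂ)) *
      (-Complex.I * (((inner ℝ y v : ℝ) : ℂ) * g y)))
    (x₀ := 0) (s := univ) (bound := fun y : E3 => ‖((inner ℝ y v : ℝ) : ℂ) * g y‖)
    univ_mem (Eventually.of_forall fun τ => (hm _).aestronglyMeasurable.mul hg.1) ?_ ?_ ?_
    hg'.norm ?_
  · refine key.2.congr_deriv ?_
    rw [← integral_const_mul]
    refine integral_congr_ae (Eventually.of_forall fun y => ?_)
    simp only [zero_smul, add_zero]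
    ring
  · refine hg.norm.mono' ((hm _).aestronglyMeasurable.mul hg.1) (Eventually.of_forall fun y => ?_)
    rw [norm_mul, norm_exp_neg_I_mul, one_mul]
  · exact (hm _).aestronglyMeasurable.mul (hg'.1.const_mul _)
  · refine Eventually.of_forall fun y τ _ => ?_
    rw [norm_mul, norm_exp_neg_I_mul, one_mul, norm_mul, norm_neg, Complex.norm_I, one_mul]
  · refine Eventually.of_forall fun y τ _ => ?_
    have h1 : HasDerivAt (fun τ : ℝ => ((inner ℝ y (ξ + τ • v) : ℝ) : ℂ))
        ((inner ℝ y v : ℝ) : ℂ) τ := by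
      simp only [inner_add_right, inner_smul_right]
      have : HasDerivAt (fun τ : ℝ => inner ℝ y ξ + τ * inner ℝ y v) (inner ℝ y v) τ := by
        simpa using ((hasDerivAt_id τ).mul_const (inner ℝ y v)).const_add (inner ℝ y ξ)
      exact this.ofReal_comp
    refine (((h1.const_mul (-Complex.I)).cexp).mul_const (g y)).congr_deriv ?_
    ring

theorem fourier_gaussian {t : ℝ} (ht : 0 < t) (ξ : E3) :
    ∫ y : E3, Complex.exp (-Complex.I * ((inner ℝ y ξ : ℝ) : ℂ)) *
      ((Real.exp (-(t * ‖y‖ ^ 2)) : ℝ) : ℂ) =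
    ((((Real.pi / t) ^ (3 / 2 : ℝ) * Real.exp (-(‖ξ‖ ^ 2 / (4 * t))) : ℝ)) : ℂ) := by
  have h := GaussianFourier.integral_cexp_neg_mul_sq_norm_add (V := E3) (b := (t : ℂ))
    (by simpa using ht) (-Complex.I) ξ
  calc _ = ∫ v : E3, Complex.exp (-(t : ℂ) * ‖v‖ ^ 2 + -Complex.I * ((inner ℝ ξ v : ℝ) : ℂ)) := by
        refine integral_congr_ae (Eventually.of_forall fun y => ?_)
        simp only
        rw [Complex.ofReal_exp, ← Complex.exp_add, real_inner_comm]
        congr 1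
        push_cast
        ring
    _ = _ := by
        rw [h, finrank_euclideanSpace_fin, Complex.ofReal_mul, Complex.ofReal_exp,
          Complex.ofReal_cpow (by positivity)]
        push_cast
        congr 2
        rw [neg_sq, Complex.I_sq]
        ring

theorem hasDerivAt_gaussian_line (t : ℝ) (ξ v : E3) :
    HasDerivAt (fun τ : ℝ => Real.exp (-(‖ξ + τ • v‖ ^ 2 / (4 * t))))
      (-(inner ℝ ξ v / (2 * t)) * Real.exp (-(‖ξ‖ ^ 2 / (4 * t)))) 0 := by
  have h1 : HasDerivAt (fun τ : ℝ => ‖ξ + τ • v‖ ^ 2) (2 * inner ℝ ξ v) 0 := by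
    have h0 : HasDerivAt (fun τ : ℝ => ξ + τ • v) v 0 := by
      simpa using ((hasDerivAt_id (0 : ℝ)).smul_const v).const_add ξ
    simpa using h0.norm_sq
  refine ((h1.div_const (4 * t)).fun_neg.exp).congr_deriv ?_
  simp only [zero_smul, add_zero]
  ring

/-- The directional derivative of the Gaussian's transform is computed twice, under the integral
sign and from the closed form. The quadratic case repeats this once more. -/
theorem fourier_inner_mul_gaussian {t : ℝ} (ht : 0 < t) (v ξ : E3) :
    ∫ y : E3, Complex.exp (-Complex.I * ((inner ℝ y ξ : ℝ) : ℂ)) *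
      (((inner ℝ y v : ℝ) : ℂ) * ((Real.exp (-(t * ‖y‖ ^ 2)) : ℝ) : ℂ)) =
    -Complex.I * ((((Real.pi / t) ^ (3 / 2 : ℝ) * (inner ℝ ξ v / (2 * t)) *
      Real.exp (-(‖ξ‖ ^ 2 / (4 * t))) : ℝ)) : ℂ) := by
  have hg : Integrable fun y : E3 => ((Real.exp (-(t * ‖y‖ ^ 2)) : ℝ) : ℂ) :=
    (integrable_exp_neg_mul_norm_sq ht).ofReal
  have hg' : Integrable fun y : E3 =>
      ((inner ℝ y v : ℝ) : ℂ) * ((Real.exp (-(t * ‖y‖ ^ 2)) : ℝ) : ℂ) := by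
    have := integrable_mul_gaussian ht (p := fun y : E3 => inner ℝ y v) (C := ‖v‖) (by fun_prop)
      fun y => by
        refine (abs_real_inner_le_norm y v).trans ?_
        rw [mul_comm]
        gcongr
        nlinarith [sq_nonneg (‖y‖ - 1)]
    simpa using this
  have h1 := hasDerivAt_fourier_integral hg v ξ hg'
  simp_rw [fourier_gaussian ht] at h1
  have h2 := ((hasDerivAt_gaussian_line t ξ v).const_mul
    ((Real.pi / t) ^ (3 / 2 : ℝ))).ofReal_comp
  have h3 := h1.unique h2
  have h4 : ∀ z w : ℂ, -Complex.I * z = w → z = Complex.I * w := by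
    rintro z w rfl
    rw [← mul_assoc, mul_neg, Complex.I_mul_I, neg_neg, one_mul]
  rw [h4 _ _ h3]
  push_cast
  ring

theorem fourier_inner_mul_inner_mul_gaussian {t : ℝ} (ht : 0 < t) (v w ξ : E3) :
    ∫ y : E3, Complex.exp (-Complex.I * ((inner ℝ y ξ : ℝ) : ℂ)) *
      ((inner ℝ y v * inner ℝ y w * Real.exp (-(t * ‖y‖ ^ 2)) : ℝ) : ℂ) =
    ((((Real.pi / t) ^ (3 / 2 : ℝ) / (2 * t) * (inner ℝ v w -
      inner ℝ ξ v * inner ℝ ξ w / (2 * t)) * Real.exp (-(‖ξ‖ ^ 2 / (4 * t))) : ℝ)) : ℂ) := by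
  have hg : Integrable fun y : E3 =>
      ((inner ℝ y v : ℝ) : ℂ) * ((Real.exp (-(t * ‖y‖ ^ 2)) : ℝ) : ℂ) := by
    have := integrable_mul_gaussian ht (p := fun y : E3 => inner ℝ y v) (C := ‖v‖) (by fun_prop)
      fun y => by
        refine (abs_real_inner_le_norm y v).trans ?_
        rw [mul_comm]
        gcongr
        nlinarith [sq_nonneg (‖y‖ - 1)]
    simpa using this
  have hg' : Integrable fun y : E3 => ((inner ℝ y w : ℝ) : ℂ) *
      (((inner ℝ y v : ℝ) : ℂ) * ((Real.exp (-(t * ‖y‖ ^ 2)) : ℝ) : ℂ)) := by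
    have := integrable_mul_gaussian ht (p := fun y : E3 => inner ℝ y w * inner ℝ y v)
      (C := ‖w‖ * ‖v‖) (by fun_prop) fun y => by
        rw [abs_mul]
        refine (mul_le_mul (abs_real_inner_le_norm y w) (abs_real_inner_le_norm y v)
          (abs_nonneg _) (by positivity)).trans ?_
        nlinarith [mul_nonneg (norm_nonneg w) (norm_nonneg v)]
    simpa [mul_assoc] using this
  have h1 := hasDerivAt_fourier_integral hg w ξ hg'
  simp_rw [fourier_inner_mul_gaussian ht] at h1
  have h0 : HasDerivAt (fun τ : ℝ => inner ℝ (ξ + τ • w) v) (inner ℝ w v) (0 : ℝ) := by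
    simp only [inner_add_left, inner_smul_left]
    simpa using ((hasDerivAt_id (0 : ℝ)).mul_const (inner ℝ w v)).const_add (inner ℝ ξ v)
  have h2 := ((((h0.div_const (2 * t)).const_mul ((Real.pi / t) ^ (3 / 2 : ℝ))).fun_mul
    (hasDerivAt_gaussian_line t ξ w)).ofReal_comp).const_mul (-Complex.I)
  have h3 := mul_left_cancel₀ (neg_ne_zero.2 Complex.I_ne_zero) (h1.unique h2)
  simp only [zero_smul, add_zero] at h3
  calc _ = _ := by
        refine integral_congr_ae (Eventually.of_forall fun y => ?_)
        simp only
        push_cast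
        ring
    _ = _ := h3
    _ = _ := by
        congr 1
        rw [real_inner_comm w v]
        ring

/-- The trace-free quadratic form is a solid harmonic, so that its product with a Gaussian is,
up to scaling, an eigenfunction of the Fourier transform. -/
theorem fourier_tracelessQuad_mul_gaussian {t : ℝ} (ht : 0 < t) (α β : Fin 3) (ξ : E3) :
    ∫ y : E3, Complex.exp (-Complex.I * ((inner ℝ y ξ : ℝ) : ℂ)) *
      ((tracelessQuad α β y * Real.exp (-(t * ‖y‖ ^ 2)) : ℝ) : ℂ) =
    ((-((Real.pi / t) ^ (3 / 2 : ℝ) / (4 * t ^ 2) * tracelessQuad α β ξ *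
      Real.exp (-(‖ξ‖ ^ 2 / (4 * t)))) : ℝ) : ℂ) := by
  let e : Fin 3 → E3 := fun γ => EuclideanSpace.single γ (1 : ℝ)
  have he : ∀ (y : E3) γ, inner ℝ y (e γ) = y γ := fun y γ => by
    simp [e, EuclideanSpace.inner_single_right]
  have hee : ∀ γ δ, inner ℝ (e γ) (e δ) = if γ = δ then (1 : ℝ) else 0 := fun γ δ => by
    rw [he]
    simp [e, eq_comm]
  have hn : ∀ y : E3, ‖y‖ ^ 2 = ∑ γ, y γ * y γ := fun y => by
    rw [EuclideanSpace.real_norm_sq_eq]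
    simp [sq]
  have hi : ∀ γ δ, Integrable fun y : E3 =>
      Complex.exp (-Complex.I * ((inner ℝ y ξ : ℝ) : ℂ)) *
        ((y γ * y δ * Real.exp (-(t * ‖y‖ ^ 2)) : ℝ) : ℂ) := by
    intro γ δ
    have h := integrable_mul_gaussian ht (p := fun y : E3 => y γ * y δ) (C := 1) (by fun_prop)
      fun y => by
        rw [abs_mul, one_mul]
        have h1 : |y γ| ≤ ‖y‖ := PiLp.norm_apply_le y γ
        have h2 : |y δ| ≤ ‖y‖ := PiLp.norm_apply_le y δ
        nlinarith [mul_le_mul h1 h2 (abs_nonneg _) (norm_nonneg y)]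
    refine h.norm.mono' (by fun_prop) (Eventually.of_forall fun y => ?_)
    rw [norm_mul, norm_exp_neg_I_mul, one_mul]
  have hval : ∀ γ δ, ∫ y : E3, Complex.exp (-Complex.I * ((inner ℝ y ξ : ℝ) : ℂ)) *
        ((y γ * y δ * Real.exp (-(t * ‖y‖ ^ 2)) : ℝ) : ℂ) =
      ((((Real.pi / t) ^ (3 / 2 : ℝ) / (2 * t) * ((if γ = δ then 1 else 0) -
        ξ γ * ξ δ / (2 * t)) * Real.exp (-(‖ξ‖ ^ 2 / (4 * t))) : ℝ)) : ℂ) := by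
    intro γ δ
    have := fourier_inner_mul_inner_mul_gaussian ht (e γ) (e δ) ξ
    simp only [hee] at this
    simpa only [he] using this
  calc _ = ∫ y : E3, (Complex.exp (-Complex.I * ((inner ℝ y ξ : ℝ) : ℂ)) *
          ((y α * y β * Real.exp (-(t * ‖y‖ ^ 2)) : ℝ) : ℂ) -
        ((1 / 3 * (if α = β then 1 else 0) : ℝ) : ℂ) *
          ∑ γ, Complex.exp (-Complex.I * ((inner ℝ y ξ : ℝ) : ℂ)) *
            ((y γ * y γ * Real.exp (-(t * ‖y‖ ^ 2)) : ℝ) : ℂ)) := by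
        refine integral_congr_ae (Eventually.of_forall fun y => ?_)
        simp only
        rw [← Finset.mul_sum, ← Complex.ofReal_sum, ← Finset.sum_mul, ← hn, tracelessQuad]
        push_cast
        ring
    _ = _ := by
        rw [integral_sub (hi α β) ((integrable_finsetSum _ fun γ _ => hi γ γ).const_mul _),
          integral_const_mul, integral_finsetSum _ fun γ _ => hi γ γ]
        simp_rw [hval]
        -- The constant terms cancel: the trace contributes 3 copies, weighted by δ/3, against the
        -- single δ from y_α y_β.
        rw [← Complex.ofReal_sum, ← Complex.ofReal_mul, ← Complex.ofReal_sub, tracelessQuad, hn ξ]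
        congr 1
        simp only [Fin.sum_univ_three, if_true]
        field_simp
        split_ifs <;> ring

/-! ### Superposition of Gaussians: Fubini and inversion -/

theorem abs_tracelessQuad_le (α β : Fin 3) (y : E3) : |tracelessQuad α β y| ≤ 2 * ‖y‖ ^ 2 := by
  have h1 : |y α| ≤ ‖y‖ := PiLp.norm_apply_le y α
  have h2 : |y β| ≤ ‖y‖ := PiLp.norm_apply_le y β
  have h3 : |y α * y β| ≤ ‖y‖ * ‖y‖ := by
    rw [abs_mul]
    exact mul_le_mul h1 h2 (abs_nonneg _) (norm_nonneg y)
  have h4 := abs_le.1 h3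
  rw [tracelessQuad, abs_le]
  split_ifs <;> constructor <;> nlinarith [sq_nonneg ‖y‖]

theorem continuous_tracelessQuad (α β : Fin 3) : Continuous (tracelessQuad α β) :=
  (contDiff_tracelessQuad α β).continuous

theorem integral_abs_tracelessQuad_mul_gaussian_le (α β : Fin 3) {t : ℝ} (ht : 0 < t) :
    ∫ y : E3, |tracelessQuad α β y| * Real.exp (-(t * ‖y‖ ^ 2)) ≤
      4 * (2 * Real.pi) ^ (3 / 2 : ℝ) * t ^ (-(5 / 2) : ℝ) := by
  have h1 : ∀ y : E3, |tracelessQuad α β y| * Real.exp (-(t * ‖y‖ ^ 2)) ≤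
      4 / t * Real.exp (-(t / 2 * ‖y‖ ^ 2)) := fun y => by
    have h := norm_sq_mul_exp_neg_le ht y
    calc _ ≤ 2 * ‖y‖ ^ 2 * Real.exp (-(t * ‖y‖ ^ 2)) := by
          gcongr
          exact abs_tracelessQuad_le α β y
      _ = 2 * (‖y‖ ^ 2 * Real.exp (-(t * ‖y‖ ^ 2))) := by ring
      _ ≤ 2 * (2 / t * Real.exp (-(t / 2 * ‖y‖ ^ 2))) := by gcongr
      _ = _ := by ring
  refine (integral_mono_of_nonneg (Eventually.of_forall fun y => by positivity)
    ((integrable_exp_neg_mul_norm_sq (half_pos ht)).const_mul (4 / t))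
    (Eventually.of_forall h1)).trans (le_of_eq ?_)
  rw [integral_const_mul]
  simp_rw [← neg_mul]
  rw [GaussianFourier.integral_rexp_neg_mul_sq_norm (half_pos ht), finrank_euclideanSpace_fin,
    show Real.pi / (t / 2) = 2 * Real.pi / t by field_simp, Nat.cast_ofNat,
    Real.div_rpow (by positivity) ht.le, show (-(5 / 2) : ℝ) = -1 - 3 / 2 by norm_num,
    Real.rpow_sub ht, Real.rpow_neg_one]
  field_simp

/-- The absolute integral over y is O(t^(-5/2)), leaving t^(-σ-5/2) on (1,∞), which is integrable
for σ > -3/2. With σ = s/2 this is the condition s > -3. -/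
theorem integrable_prod_tracelessQuad_gaussian (α β : Fin 3) {σ : ℝ} (hσ : -(3 / 2) < σ) (ξ : E3) :
    Integrable (fun p : E3 × ℝ => Complex.exp (-Complex.I * ((inner ℝ p.1 ξ : ℝ) : ℂ)) *
      ((tracelessQuad α β p.1 * (p.2 ^ (-σ) * Real.exp (-(p.2 * ‖p.1‖ ^ 2))) : ℝ) : ℂ))
      (volume.prod (volume.restrict (Ioi 1))) := by
  have hP := continuous_tracelessQuad α β
  have hm : AEStronglyMeasurable (fun p : E3 × ℝ =>
      Complex.exp (-Complex.I * ((inner ℝ p.1 ξ : ℝ) : ℂ)) *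
      ((tracelessQuad α β p.1 * (p.2 ^ (-σ) * Real.exp (-(p.2 * ‖p.1‖ ^ 2))) : ℝ) : ℂ))
      (volume.prod (volume.restrict (Ioi 1))) := by
    have := hP.measurable
    have h1 : Measurable fun p : E3 × ℝ => tracelessQuad α β p.1 := this.comp measurable_fst
    refine Measurable.aestronglyMeasurable ?_
    fun_prop
  have hn : ∀ t : ℝ, 0 < t → ∀ y : E3, ‖Complex.exp (-Complex.I * ((inner ℝ y ξ : ℝ) : ℂ)) *
      ((tracelessQuad α β y * (t ^ (-σ) * Real.exp (-(t * ‖y‖ ^ 2))) : ℝ) : ℂ)‖ =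
      t ^ (-σ) * (|tracelessQuad α β y| * Real.exp (-(t * ‖y‖ ^ 2))) := by
    intro t ht y
    rw [norm_mul, norm_exp_neg_I_mul, one_mul, Complex.norm_real, norm_mul, Real.norm_eq_abs,
      Real.norm_of_nonneg (by positivity)]
    ring
  rw [integrable_prod_iff' hm]
  constructor
  · refine (ae_restrict_iff' measurableSet_Ioi).2 (Eventually.of_forall fun t ht => ?_)
    have ht0 : (0 : ℝ) < t := zero_lt_one.trans ht
    have h := (integrable_mul_gaussian ht0 hP (C := 2) fun y =>
      (abs_tracelessQuad_le α β y).trans (by linarith)).norm.const_mul (t ^ (-σ))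
    refine h.mono' (by fun_prop) (Eventually.of_forall fun y => ?_)
    simp only
    rw [hn t ht0, Complex.norm_real, norm_mul, Real.norm_eq_abs,
      Real.norm_of_nonneg (Real.exp_pos _).le]
  · have hb : IntegrableOn (fun t : ℝ => 4 * (2 * Real.pi) ^ (3 / 2 : ℝ) * t ^ (-σ - 5 / 2))
        (Ioi 1) :=
      (integrableOn_Ioi_rpow_of_lt (by linarith) zero_lt_one).const_mul _
    refine hb.mono' hm.norm.prod_swap.integral_prod_right'
      ((ae_restrict_iff' measurableSet_Ioi).2 (Eventually.of_forall fun t ht => ?_))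
    have ht0 : (0 : ℝ) < t := zero_lt_one.trans ht
    rw [Real.norm_of_nonneg (integral_nonneg fun _ => norm_nonneg _)]
    simp_rw [hn t ht0]
    rw [integral_const_mul]
    calc _ ≤ t ^ (-σ) * (4 * (2 * Real.pi) ^ (3 / 2 : ℝ) * t ^ (-(5 / 2) : ℝ)) := by
          gcongr
          exact integral_abs_tracelessQuad_mul_gaussian_le α β ht0
      _ = _ := by
          rw [sub_eq_add_neg (-σ), Real.rpow_add ht0]
          ring

theorem integral_tracelessQuad_mul_rpow_mul_exp (α β : Fin 3) (σ : ℝ) (y : E3) :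
    ∫ t in Ioi (1 : ℝ), ((tracelessQuad α β y * (t ^ (-σ) * Real.exp (-(t * ‖y‖ ^ 2))) : ℝ) : ℂ) =
      ((tracelessQuad α β y * laplaceOn (Ioi 1) (-σ) (‖y‖ ^ 2) : ℝ) : ℂ) := by
  rw [integral_complex_ofReal, integral_const_mul]
  rfl

theorem integrable_tracelessQuad_mul_laplaceOn (α β : Fin 3) {σ : ℝ} (hσ : -(3 / 2) < σ) :
    Integrable (fun y : E3 => tracelessQuad α β y * laplaceOn (Ioi 1) (-σ) (‖y‖ ^ 2)) := by
  have h := (integrable_prod_tracelessQuad_gaussian α β hσ 0).integral_prod_left.re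
  refine h.congr (Eventually.of_forall fun y => ?_)
  simp only [inner_zero_right, Complex.ofReal_zero, mul_zero, Complex.exp_zero, one_mul]
  rw [integral_tracelessQuad_mul_rpow_mul_exp]
  simp

/-- The substitution `t ↦ 1 / t`. -/
theorem integral_Ioi_one_rpow_mul_exp_div (τ x : ℝ) :
    ∫ t in Ioi (1 : ℝ), t ^ (-τ - 2) * Real.exp (-(x / t)) = laplaceOn (Ioo 0 1) τ x := by
  have h := integral_comp_rpow_Ioi
    (fun u : ℝ => (Iio (1 : ℝ)).indicator (fun u => u ^ τ * Real.exp (-(u * x))) u)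
    (p := -1) (by norm_num)
  rw [setIntegral_indicator measurableSet_Iio, Ioi_inter_Iio] at h
  rw [laplaceOn, ← h]
  have h2 : ∀ t ∈ Ioi (0 : ℝ), (|(-1 : ℝ)| * t ^ ((-1 : ℝ) - 1)) •
      (Iio (1 : ℝ)).indicator (fun u => u ^ τ * Real.exp (-(u * x))) (t ^ (-1 : ℝ)) =
      (Ioi (1 : ℝ)).indicator (fun t => t ^ (-τ - 2) * Real.exp (-(x / t))) t := by
    intro t ht
    have ht0 : 0 < t := ht
    rw [Real.rpow_neg_one]
    by_cases h1 : 1 < t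
    · rw [indicator_of_mem (show t⁻¹ ∈ Iio (1 : ℝ) from inv_lt_one_of_one_lt₀ h1),
        indicator_of_mem (show t ∈ Ioi (1 : ℝ) from h1), abs_neg, abs_one, one_mul, smul_eq_mul,
        Real.inv_rpow ht0.le, ← Real.rpow_neg ht0.le, ← mul_assoc, ← Real.rpow_add ht0]
      congr 2
      · ring
      · rw [inv_mul_eq_div]
    · rw [indicator_of_notMem (show t ∉ Ioi (1 : ℝ) from h1), indicator_of_notMem, smul_zero]
      simp only [mem_Iio, not_lt]
      exact (one_le_inv₀ ht0).2 (not_lt.1 h1)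
  rw [setIntegral_congr_fun measurableSet_Ioi h2, setIntegral_indicator measurableSet_Ioi,
    Ioi_inter_Ioi, max_eq_right zero_le_one]

theorem fourier_tracelessQuad_mul_laplaceOn (α β : Fin 3) {σ : ℝ} (hσ : -(3 / 2) < σ) (ξ : E3) :
    ∫ y : E3, Complex.exp (-Complex.I * ((inner ℝ y ξ : ℝ) : ℂ)) *
      ((tracelessQuad α β y * laplaceOn (Ioi 1) (-σ) (‖y‖ ^ 2) : ℝ) : ℂ) =
    ((-(Real.pi ^ (3 / 2 : ℝ) / 4 * tracelessQuad α β ξ *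
      laplaceOn (Ioo 0 1) (σ + 3 / 2) (‖ξ‖ ^ 2 / 4)) : ℝ) : ℂ) := by
  have hi := integrable_prod_tracelessQuad_gaussian α β hσ ξ
  calc _ = ∫ y : E3, ∫ t in Ioi (1 : ℝ), Complex.exp (-Complex.I * ((inner ℝ y ξ : ℝ) : ℂ)) *
      ((tracelessQuad α β y * (t ^ (-σ) * Real.exp (-(t * ‖y‖ ^ 2))) : ℝ) : ℂ) := by
        refine integral_congr_ae (Eventually.of_forall fun y => ?_)
        simp only
        rw [integral_const_mul, integral_tracelessQuad_mul_rpow_mul_exp]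
    _ = ∫ t in Ioi (1 : ℝ), ∫ y : E3, Complex.exp (-Complex.I * ((inner ℝ y ξ : ℝ) : ℂ)) *
      ((tracelessQuad α β y * (t ^ (-σ) * Real.exp (-(t * ‖y‖ ^ 2))) : ℝ) : ℂ) :=
        integral_integral_swap hi
    _ = ∫ t in Ioi (1 : ℝ), ((-(Real.pi ^ (3 / 2 : ℝ) / 4 * tracelessQuad α β ξ) *
        (t ^ (-(σ + 3 / 2) - 2) * Real.exp (-(‖ξ‖ ^ 2 / 4 / t))) : ℝ) : ℂ) := by
        refine setIntegral_congr_fun measurableSet_Ioi fun t ht => ?_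
        have ht0 : (0 : ℝ) < t := zero_lt_one.trans ht
        have h := fourier_tracelessQuad_mul_gaussian ht0 α β ξ
        have e : ∀ y : E3, Complex.exp (-Complex.I * ((inner ℝ y ξ : ℝ) : ℂ)) *
            ((tracelessQuad α β y * (t ^ (-σ) * Real.exp (-(t * ‖y‖ ^ 2))) : ℝ) : ℂ) =
            ((t ^ (-σ) : ℝ) : ℂ) * (Complex.exp (-Complex.I * ((inner ℝ y ξ : ℝ) : ℂ)) *
            ((tracelessQuad α β y * Real.exp (-(t * ‖y‖ ^ 2)) : ℝ) : ℂ)) := fun y => by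
          push_cast
          ring
        simp_rw [e]
        rw [integral_const_mul, h, ← Complex.ofReal_mul]
        congr 1
        rw [Real.div_rpow Real.pi_pos.le ht0.le,
          show -(σ + 3 / 2) - 2 = -σ - 3 / 2 - (2 : ℕ) by push_cast; ring,
          Real.rpow_sub_natCast ht0.ne', Real.rpow_sub ht0, div_div]
        field_simp
    _ = _ := by
        rw [integral_complex_ofReal, integral_const_mul, integral_Ioi_one_rpow_mul_exp_div]
        congr 1
        ring

/-! ### The constant c(s) -/

/-- Reflection at s/2 trades the sine for 1/Γ(1-s/2), and duplication at s/2 + 2 splits Γ(s+4). In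
this form the singularities at s = 0 and s = -2 are gone. -/
theorem refConst_eq {s : ℝ} (hs : -3 < s) :
    refConst s = -(Real.pi ^ (3 / 2 : ℝ) * 2 ^ (s + 3) * Real.Gamma (s / 2 + 5 / 2) *
      (Real.Gamma (1 - s / 2))⁻¹) := by
  have hpi : Real.pi ^ (3 / 2 : ℝ) = Real.pi * √Real.pi := by
    rw [Real.sqrt_eq_rpow, ← Real.rpow_one_add' Real.pi_pos.le (by norm_num)]
    norm_num
  have hsq : √Real.pi * √Real.pi = Real.pi := Real.mul_self_sqrt Real.pi_pos.le
  have h32 : Real.Gamma (3 / 2) = √Real.pi / 2 := by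
    rw [show (3 / 2 : ℝ) = 1 / 2 + 1 by norm_num, Real.Gamma_add_one (by norm_num),
      Real.Gamma_one_half_eq]
    ring
  rw [refConst, hpi]
  split_ifs with h0 h2
  · subst h0
    rw [show (0 : ℝ) / 2 + 5 / 2 = 3 / 2 + 1 by norm_num, Real.Gamma_add_one (by norm_num), h32,
      show (0 : ℝ) + 3 = (3 : ℕ) by norm_num, Real.rpow_natCast]
    norm_num
    linear_combination -6 * Real.pi * hsq
  · subst h2
    rw [show (-2 : ℝ) / 2 + 5 / 2 = 3 / 2 by norm_num, h32,
      show (-2 : ℝ) + 3 = 1 by norm_num, Real.rpow_one, show 1 - (-2 : ℝ) / 2 = 2 by norm_num,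
      Real.Gamma_two]
    linear_combination Real.pi * hsq
  · have hs2 : s + 2 ≠ 0 := fun h => h2 (by linarith)
    have hΓ : Real.Gamma (s / 2) ≠ 0 := by
      refine Real.Gamma_ne_zero fun m hm => ?_
      have hm' : s = -(2 * m) := by linarith
      rcases m with _ | _ | m
      · apply h0; simpa using hm'
      · apply h2; rw [hm']; norm_num
      · rw [hm'] at hs
        push_cast at hs
        have : (0 : ℝ) ≤ m := m.cast_nonneg
        linarith
    have hinv : (Real.Gamma (1 - s / 2))⁻¹ =
        Real.Gamma (s / 2) * Real.sin (Real.pi * s / 2) / Real.pi := by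
      have h := Real.Gamma_mul_Gamma_one_sub (s / 2)
      rw [← mul_div_assoc] at h
      -- If the sine vanishes, reflection reads Γ(s/2) Γ(1-s/2) = 0 under division by zero, so
      -- Γ(1-s/2) takes its default value 0 and both sides are 0.
      by_cases hsin : Real.sin (Real.pi * s / 2) = 0
      · rw [hsin, div_zero] at h
        rw [(mul_eq_zero.1 h).resolve_left hΓ, hsin]
        simp
      · have : Real.Gamma (1 - s / 2) ≠ 0 := by
          intro h'
          rw [h', mul_zero] at h
          exact (div_ne_zero Real.pi_ne_zero hsin) h.symm
        rw [eq_div_iff hsin] at h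
        rw [eq_div_iff Real.pi_ne_zero, inv_mul_eq_iff_eq_mul₀ this]
        linear_combination -h
    have hdup := Real.Gamma_mul_Gamma_add_half (s / 2 + 2)
    rw [show s / 2 + 2 = s / 2 + 1 + 1 by ring, Real.Gamma_add_one (by
        intro h; apply hs2; linarith), Real.Gamma_add_one (by
        intro h; apply h0; linarith), show s / 2 + 1 + 1 + 1 / 2 = s / 2 + 5 / 2 by ring,
      show 2 * (s / 2 + 1 + 1) = s + 4 by ring, show 1 - (s + 4) = -(s + 3) by ring,
      Real.rpow_neg zero_le_two] at hdup
    have hpow : (2 : ℝ) ^ (s + 3) ≠ 0 := by positivity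
    have hmul : Real.Gamma (s + 4) * √Real.pi = 2 ^ (s + 3) * (s * (s + 2) / 4 *
        (Real.Gamma (s / 2) * Real.Gamma (s / 2 + 5 / 2))) := by
      have := congrArg (fun z => 2 ^ (s + 3) * z) hdup
      rw [mul_assoc (Real.Gamma (s + 4)), mul_left_comm (Real.Gamma (s + 4)),
        mul_inv_cancel_left₀ hpow] at this
      rw [← this]
      ring
    have hdiv : 4 * Real.pi * Real.Gamma (s + 4) / (s * (s + 2)) = √Real.pi * 2 ^ (s + 3) *
        (Real.Gamma (s / 2) * Real.Gamma (s / 2 + 5 / 2)) := by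
      rw [div_eq_iff (mul_ne_zero h0 hs2)]
      linear_combination 4 * √Real.pi * hmul - 4 * Real.Gamma (s + 4) * hsq
    rw [hinv, hdiv]
    field_simp

/-! ### Cut-offs producing bounded Schwartz families -/

/-- A smooth function that is constant near both ends of the line has bounded derivatives. -/
theorem exists_abs_iteratedDeriv_le {θ : ℝ → ℝ} (hθ : ContDiff ℝ ∞ θ) {a b c d : ℝ}
    (ha : ∀ x < a, θ x = c) (hb : ∀ x, b < x → θ x = d) (n : ℕ) :
    ∃ C, ∀ x, |iteratedDeriv n θ x| ≤ C := by
  have hconst : ∀ e x : ℝ, |iteratedDeriv n (fun _ : ℝ => e) x| ≤ |e| := by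
    intro e x
    rw [iteratedDeriv_const]
    split_ifs
    · exact le_rfl
    · simp
  obtain ⟨C, hC⟩ := (isCompact_Icc (a := a) (b := b)).exists_bound_of_continuousOn
    (hθ.continuous_iteratedDeriv n (by exact_mod_cast le_top)).continuousOn
  refine ⟨max C (max |c| |d|), fun x => ?_⟩
  rcases lt_or_ge x a with hx | hx
  · have : θ =ᶠ[𝓝 x] fun _ => c := by
      filter_upwards [Iio_mem_nhds hx] with y hy using ha y hy
    rw [this.iteratedDeriv_eq n]
    exact (hconst c x).trans ((le_max_left _ _).trans (le_max_right _ _))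
  · rcases lt_or_ge b x with hx' | hx'
    · have : θ =ᶠ[𝓝 x] fun _ => d := by
        filter_upwards [Ioi_mem_nhds hx'] with y hy using hb y hy
      rw [this.iteratedDeriv_eq n]
      exact (hconst d x).trans ((le_max_right _ _).trans (le_max_right _ _))
    · exact (hC x ⟨hx, hx'⟩).trans (le_max_left _ _)

theorem tsupport_subset_Ici {θ : ℝ → ℝ} {δ : ℝ} (h : ∀ x < δ, θ x = 0) : tsupport θ ⊆ Ici δ :=
  closure_minimal (fun x hx => not_lt.1 fun hlt => hx (h x hlt)) isClosed_Ici

theorem exists_schwartzBounded_cutoff_mul_laplaceOn {S : Set ℝ} {θ : ℝ → ℝ} (hθ : ContDiff ℝ ∞ θ)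
    {δ b d : ℝ} (hδ : 0 < δ) (h0 : ∀ x < δ, θ x = 0) (hb : ∀ x, b < x → θ x = d) {u : ℝ → ℝ} {B : ℝ}
    (hu : ∀ s ∈ S, u s ≤ B) :
    ∃ Φ : ℝ → 𝓢(ℝ, ℂ), SchwartzBounded S Φ ∧
      ∀ s ∈ S, ∀ x, Φ s x = ((θ x * laplaceOn (Ioi 1) (u s) x : ℝ) : ℂ) := by
  have hsub := tsupport_subset_Ici h0
  refine exists_schwartzBounded_cutoff_mul hθ (exists_abs_iteratedDeriv_le hθ h0 hb)
    isOpen_Ioi (hsub.trans (Ici_subset_Ioi.2 hδ)) (G := fun s => laplaceOn (Ioi 1) (u s))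
    (fun s _ => contDiffOn_laplaceOn_Ioi_one (u s)) fun k n => ?_
  obtain ⟨C, hC⟩ := exists_pow_mul_iteratedDeriv_laplaceOn_Ioi_one_le B δ hδ k n
  exact ⟨C, fun s hs x hx => hC (u s) (hu s hs) x (hsub hx)⟩

theorem exists_schwartzBounded_cutoff_mul_of_uniformlySmooth {S : Set ℝ} {θ : ℝ → ℝ}
    (hθ : ContDiff ℝ ∞ θ) {X : ℝ} (h0 : ∀ x, X < |x| → θ x = 0) {G : ℝ → ℝ → ℝ}
    (hG : UniformlySmooth S G) :
    ∃ Φ : ℝ → 𝓢(ℝ, ℂ), SchwartzBounded S Φ ∧ ∀ s ∈ S, ∀ x, Φ s x = ((θ x * G s x : ℝ) : ℂ) := by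
  have hsub : tsupport θ ⊆ {x | |x| ≤ X} :=
    closure_minimal (fun x hx => not_lt.1 fun hlt => hx (h0 x hlt))
      (isClosed_le continuous_abs continuous_const)
  refine exists_schwartzBounded_cutoff_mul hθ
    (exists_abs_iteratedDeriv_le hθ (a := -X) (b := X) (c := 0) (d := 0)
      (fun x hx => h0 x (lt_of_lt_of_le (by linarith) (neg_le_abs x)))
      (fun x hx => h0 x (hx.trans_le (le_abs_self x))))
    isOpen_univ (subset_univ _) (fun s hs => (hG.contDiff s hs).contDiffOn) fun k n => ?_
  obtain ⟨C, hC⟩ := hG.bound n X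
  refine ⟨X ^ k * C, fun s hs x hx => ?_⟩
  have h1 : |x| ≤ X := hsub hx
  have h2 := hC s hs x h1
  have h3 : 0 ≤ X := (abs_nonneg x).trans h1
  gcongr

namespace IsRadialCutoff

variable {χ : ℝ → ℝ}

/-- As a function of the squared radius, a radial cut-off extends smoothly to the line. -/
theorem contDiff_comp_sqrt (hχ : IsRadialCutoff χ) :
    ContDiff ℝ ∞ fun x => χ (√x) := by
  obtain ⟨ε, hε, h1⟩ := hχ.eq_one_near_zero
  rw [contDiff_iff_contDiffAt]
  intro x
  rcases lt_or_ge x (ε ^ 2) with hx | hx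
  · refine contDiffAt_const (c := (1 : ℝ)) |>.congr_of_eventuallyEq ?_
    filter_upwards [Iio_mem_nhds hx] with y hy
    exact h1 _ (Real.sqrt_nonneg y) ((Real.sqrt_lt' hε).2 hy)
  · have hx0 : 0 < x := lt_of_lt_of_le (by positivity) hx
    exact (hχ.smooth.contDiffAt (Ici_mem_nhds (Real.sqrt_pos.2 hx0))).comp x
      (Real.contDiffAt_sqrt hx0.ne')

theorem exists_comp_sqrt_eq_one (hχ : IsRadialCutoff χ) :
    ∃ δ : ℝ, 0 < δ ∧ ∀ x < δ, χ (√x) = 1 := by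
  obtain ⟨ε, hε, h1⟩ := hχ.eq_one_near_zero
  exact ⟨ε ^ 2, by positivity, fun x hx => h1 _ (Real.sqrt_nonneg x) ((Real.sqrt_lt' hε).2 hx)⟩

theorem exists_comp_sqrt_eq_zero (hχ : IsRadialCutoff χ) :
    ∃ b : ℝ, ∀ x, b < x → χ (√x) = 0 := by
  obtain ⟨R, hR⟩ := hχ.compact_support
  exact ⟨R ^ 2, fun x hx => hR _ (Real.sqrt_nonneg x) (Real.le_sqrt_of_sq_le hx.le)⟩

end IsRadialCutoff

/-! ### Assembly -/

/-- The remainder splits into a bounded family of Schwartz functions and an explicit incomplete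
Laplace-type integral. -/
theorem exists_refRemainder_eq {χ : ℝ → ℝ} (hχ : IsRadialCutoff χ) (α β : Fin 3) {a b : ℝ}
    (ha : -3 < a) :
    ∃ Ψ : ℝ → 𝓢(E3, ℂ), SchwartzBounded (Icc a b) Ψ ∧ ∀ s ∈ Icc a b,
      Integrable (refKernel χ s α β) ∧ ∀ ξ : E3, ξ ≠ 0 → refRemainder χ s α β ξ = Ψ s ξ +
        ((Real.pi ^ (3 / 2 : ℝ) / 4 * (Real.Gamma (1 - s / 2))⁻¹ * (tracelessQuad α β ξ *
          laplaceOn (Ioi 1) (s / 2 + 3 / 2) (1 / 4 * ‖ξ‖ ^ 2)) : ℝ) : ℂ) := by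
  obtain ⟨δ, hδ, hone⟩ := hχ.exists_comp_sqrt_eq_one
  obtain ⟨R, hzero⟩ := hχ.exists_comp_sqrt_eq_zero
  have hsm := hχ.contDiff_comp_sqrt
  have hmap : MapsTo (fun s : ℝ => s / 2) (Icc a b) (Icc (a / 2) (b / 2)) :=
    fun s hs => ⟨by linarith [hs.1], by linarith [hs.2]⟩
  obtain ⟨n, hn⟩ := exists_nat_gt (b / 2)
  obtain ⟨G, hG, hG'⟩ := exists_rpow_eq_laplaceOn_add n (a / 2) (b / 2) (by linarith)
  obtain ⟨M, hM⟩ := exists_abs_inv_Gamma_one_sub_le (a / 2) (b / 2)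
  obtain ⟨Φ₁, hΦ₁, hΦ₁'⟩ := exists_schwartzBounded_cutoff_mul_of_uniformlySmooth
    (hsm.mul (Real.smoothTransition.contDiff.comp (contDiff_id.add contDiff_const)))
    -- As √x = 0 for x < 0, χ(√x) is 1 on the negative axis. The extra factor makes the support
    -- compact and equals 1 for x ≥ 0.
    (θ := fun x => χ (√x) * Real.smoothTransition (x + 1)) (X := max R 1)
    (fun x hx => by
      rcases le_total 0 x with h | h
      · rw [abs_of_nonneg h] at hx
        rw [hzero x ((le_max_left _ _).trans_lt hx), zero_mul]
      · rw [abs_of_nonpos h] at hx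
        have := (le_max_right R 1).trans_lt hx
        rw [Real.smoothTransition.zero_of_nonpos (by linarith), mul_zero])
    (hG.comp_param hmap)
  obtain ⟨Φ₂, hΦ₂, hΦ₂'⟩ := exists_schwartzBounded_cutoff_mul_laplaceOn (S := Icc a b)
    (contDiff_const.sub hsm) (θ := fun x => 1 - χ (√x)) hδ (fun x hx => by rw [hone x hx, sub_self])
    (b := R) (d := 1) (fun x hx => by rw [hzero x hx, sub_zero]) (u := fun s => -(s / 2))
    (B := -(a / 2)) (fun s hs => by linarith [hs.1])
  obtain ⟨T, hT⟩ := exists_radialLift α β one_pos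
  obtain ⟨𝓛, h𝓛⟩ := exists_fourier_exp_neg_inner
  -- With L the integral over (1,∞), χ(L/Γ + G) = L/Γ - (1-χ)L/Γ + χG; the last two terms form K.
  let K : ℝ → 𝓢(E3, ℂ) := fun s => T (Φ₁ s + (-(Real.Gamma (1 - s / 2))⁻¹) • Φ₂ s)
  have hK : SchwartzBounded (Icc a b) K := (hΦ₁.add (hΦ₂.smul (M := M) fun s hs => by
    rw [abs_neg]
    exact hM _ (hmap hs))).map T
  refine ⟨fun s => 𝓛 (K s), hK.map 𝓛, fun s hs => ?_⟩
  have hs3 : -(3 / 2) < s / 2 := by linarith [hs.1]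
  have hker : ∀ y : E3, ((refKernel χ s α β y : ℝ) : ℂ) = (((Real.Gamma (1 - s / 2))⁻¹ : ℝ) : ℂ) *
      ((tracelessQuad α β y * laplaceOn (Ioi 1) (-(s / 2)) (‖y‖ ^ 2) : ℝ) : ℂ) + K s y := by
    intro y
    simp only [K, hT, add_apply, smul_apply, hΦ₁' s hs, hΦ₂' s hs,
      Complex.real_smul, one_mul, refKernel]
    rw [Real.sqrt_sq (norm_nonneg y), Real.smoothTransition.one_of_one_le
      (by linarith [sq_nonneg ‖y‖]), mul_one]
    split_ifs with hy
    · subst hy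
      simp [tracelessQuad]
    · have hy0 : 0 < ‖y‖ := norm_pos_iff.2 hy
      have h := hG' _ (hmap hs) (‖y‖ ^ 2) (by positivity)
      have e : (‖y‖ ^ 2) ^ (s / 2 - 1) = (‖y‖ ^ (2 - s))⁻¹ := by
        rw [← Real.rpow_natCast, ← Real.rpow_mul hy0.le, ← Real.rpow_neg hy0.le]
        congr 1
        push_cast
        ring
      simp only at h
      rw [e] at h
      rw [div_eq_mul_inv, h]
      push_cast
      ring
  have hint : Integrable fun y : E3 => (((Real.Gamma (1 - s / 2))⁻¹ : ℝ) : ℂ) *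
      ((tracelessQuad α β y * laplaceOn (Ioi 1) (-(s / 2)) (‖y‖ ^ 2) : ℝ) : ℂ) :=
    ((integrable_tracelessQuad_mul_laplaceOn α β hs3).ofReal).const_mul _
  constructor
  · have h : Integrable fun y : E3 => ((refKernel χ s α β y : ℝ) : ℂ) := by
      simp_rw [hker]
      exact hint.add (K s).integrable
    exact h.re
  · intro ξ hξ
    have hξ0 : 0 < ‖ξ‖ := norm_pos_iff.2 hξ
    have hexp : ∀ {f : E3 → ℂ}, Integrable f → Integrable fun y : E3 =>
        Complex.exp (-Complex.I * ((inner ℝ y ξ : ℝ) : ℂ)) * f y := fun {f} hf => by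
      have hc : Continuous fun y : E3 => Complex.exp (-Complex.I * ((inner ℝ y ξ : ℝ) : ℂ)) := by
        fun_prop
      refine hf.norm.mono' (hc.aestronglyMeasurable.mul hf.1) (Eventually.of_forall fun y => ?_)
      rw [norm_mul, norm_exp_neg_I_mul, one_mul]
    have hhat : refKernelHat χ s α β ξ = (((Real.Gamma (1 - s / 2))⁻¹ : ℝ) : ℂ) *
        ((-(Real.pi ^ (3 / 2 : ℝ) / 4 * tracelessQuad α β ξ *
        laplaceOn (Ioo 0 1) (s / 2 + 3 / 2) (‖ξ‖ ^ 2 / 4)) : ℝ) : ℂ) + 𝓛 (K s) ξ := by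
      rw [refKernelHat, h𝓛, ← fourier_tracelessQuad_mul_laplaceOn α β hs3 ξ, ← integral_const_mul,
        ← integral_add _ (hexp (K s).integrable)]
      · refine integral_congr_ae (Eventually.of_forall fun y => ?_)
        simp only
        rw [hker y]
        ring
      · simpa only [mul_left_comm] using hexp hint
    -- The (0,1) integral is Euler's full integral, which is the leading term, minus the (1,∞) tail.
    have hsplit := laplaceOn_Ioo_add_laplaceOn_Ioi (σ := s / 2 + 3 / 2) (x := ‖ξ‖ ^ 2 / 4)
      (by linarith) (by positivity)
    have hpow : (‖ξ‖ ^ 2 / 4) ^ (-(s / 2 + 3 / 2) - 1) = 4 * 2 ^ (s + 3) * (‖ξ‖ ^ (5 + s))⁻¹ := by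
      rw [show ‖ξ‖ ^ 2 / 4 = (‖ξ‖ / 2) ^ (2 : ℝ) by rw [Real.rpow_two]; ring,
        ← Real.rpow_mul (by positivity), show 2 * (-(s / 2 + 3 / 2) - 1) = -(5 + s) by ring,
        Real.rpow_neg (by positivity), Real.div_rpow hξ0.le zero_le_two, inv_div,
        show 5 + s = s + 3 + 2 by ring, Real.rpow_add two_pos, Real.rpow_two]
      ring
    rw [hpow, show s / 2 + 3 / 2 + 1 = s / 2 + 5 / 2 by ring] at hsplit
    rw [refRemainder, hhat, refConst_eq (by linarith [hs.1]), eq_sub_iff_add_eq.2 hsplit,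
      show ‖ξ‖ ^ 2 / 4 = 1 / 4 * ‖ξ‖ ^ 2 by ring]
    push_cast
    ring

theorem contDiffOn_tracelessQuad_mul_laplaceOn (α β : Fin 3) (τ : ℝ) :
    ContDiffOn ℝ ∞ (fun ξ : E3 => tracelessQuad α β ξ * laplaceOn (Ioi 1) τ (1 / 4 * ‖ξ‖ ^ 2))
      {ξ | ξ ≠ 0} :=
  (contDiff_tracelessQuad α β).contDiffOn.mul
    ((contDiffOn_laplaceOn_Ioi_one τ).comp (contDiff_const.mul (contDiff_norm_sq ℝ)).contDiffOn
      fun ξ hξ => by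
        have : 0 < ‖ξ‖ := norm_pos_iff.2 hξ
        simp only [mem_Ioi]
        positivity)

/-- Cutting the tail off near ξ = 0 makes it Schwartz without changing it for large ξ, so the
remainder agrees there with a bounded Schwartz family. -/
theorem exists_norm_iteratedFDeriv_refRemainder_le {χ : ℝ → ℝ} (hχ : IsRadialCutoff χ)
    (α β : Fin 3) {a b : ℝ} (ha : -3 < a) (k N : ℕ) :
    ∃ C : ℝ, ∀ s ∈ Icc a b, ∀ ξ : E3, 3 ≤ ‖ξ‖ →
      ‖iteratedFDeriv ℝ k (refRemainder χ s α β) ξ‖ ≤ C / ‖ξ‖ ^ N := by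
  obtain ⟨Ψ, hΨ, hΨ'⟩ := exists_refRemainder_eq hχ α β (b := b) ha
  obtain ⟨M, hM⟩ := exists_abs_inv_Gamma_one_sub_le (a / 2) (b / 2)
  obtain ⟨Φ, hΦ, hΦ'⟩ := exists_schwartzBounded_cutoff_mul_laplaceOn (S := Icc a b)
    (Real.smoothTransition.contDiff.comp ((contDiff_const.mul contDiff_id).sub contDiff_const))
    (θ := fun x => Real.smoothTransition (2 * x - 1)) (δ := 1 / 2) (by norm_num)
    (fun x hx => Real.smoothTransition.zero_of_nonpos (by linarith)) (b := 1) (d := 1)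
    (fun x hx => Real.smoothTransition.one_of_one_le (by linarith))
    (u := fun s => s / 2 + 3 / 2) (B := b / 2 + 3 / 2) (fun s hs => by linarith [hs.2])
  obtain ⟨T, hT⟩ := exists_radialLift α β (show (0 : ℝ) < 1 / 4 by norm_num)
  have hΩ : SchwartzBounded (Icc a b) fun s => Ψ s +
      T ((Real.pi ^ (3 / 2 : ℝ) / 4 * (Real.Gamma (1 - s / 2))⁻¹) • Φ s) := by
    refine hΨ.add ((hΦ.smul (M := Real.pi ^ (3 / 2 : ℝ) / 4 * M) fun s hs => ?_).map T)
    rw [abs_mul, abs_of_pos (by positivity)]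
    gcongr
    exact hM _ ⟨by linarith [hs.1], by linarith [hs.2]⟩
  obtain ⟨C, hC⟩ := hΩ N k
  refine ⟨C, fun s hs ξ hξ => ?_⟩
  have heq : refRemainder χ s α β =ᶠ[𝓝 ξ]
      ⇑(Ψ s + T ((Real.pi ^ (3 / 2 : ℝ) / 4 * (Real.Gamma (1 - s / 2))⁻¹) • Φ s)) := by
    -- For ‖η‖ > 2 the argument ‖η‖²/4 exceeds 1, where the cut-off is 1; the radius 3 leaves room
    -- for a neighbourhood.
    have ho : {η : E3 | 2 < ‖η‖} ∈ 𝓝 ξ :=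
      (isOpen_lt continuous_const continuous_norm).mem_nhds
        (show (2 : ℝ) < ‖ξ‖ by linarith)
    filter_upwards [ho] with η hη
    have hη2 : (2 : ℝ) < ‖η‖ := hη
    have hη0 : η ≠ 0 := norm_pos_iff.1 (by linarith)
    rw [(hΨ' s hs).2 η hη0, add_apply, hT, smul_apply, hΦ' s hs,
      Real.smoothTransition.one_of_one_le (by nlinarith), one_mul, Complex.real_smul]
    push_cast
    ring
  rw [(heq.iteratedFDeriv ℝ k).eq_of_nhds, le_div_iff₀ (by positivity), mul_comm]
  exact (SchwartzMap.le_seminorm ℝ N k _ ξ).trans (hC s hs)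

theorem propositionC1 (χ : ℝ → ℝ) (hχ : IsRadialCutoff χ) (α β : Fin 3) :
    (∀ s : ℝ, -3 < s →
      MeasureTheory.Integrable (refKernel χ s α β) ∧
      ContDiffOn ℝ ∞ (refRemainder χ s α β) {ξ | ξ ≠ 0}) ∧
    (∀ a b : ℝ, -3 < a → a ≤ b → ∀ k N : ℕ, ∃ C R : ℝ, 0 < R ∧
      ∀ s ∈ Set.Icc a b, ∀ ξ : EuclideanSpace ℝ (Fin 3), R ≤ ‖ξ‖ →
        ‖iteratedFDeriv ℝ k (refRemainder χ s α β) ξ‖ ≤ C / ‖ξ‖ ^ N) := by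

  refine ⟨fun s hs => ?_, fun a b ha _ k N => ?_⟩
  · obtain ⟨Ψ, -, hΨ⟩ := exists_refRemainder_eq hχ α β (b := s) hs
    obtain ⟨hint, heq⟩ := hΨ s ⟨le_rfl, le_rfl⟩
    refine ⟨hint, ContDiffOn.congr ?_ heq⟩
    exact ((Ψ s).smooth ⊤).contDiffOn.add (Complex.ofRealCLM.contDiff.comp_contDiffOn
      (contDiffOn_const.mul (contDiffOn_tracelessQuad_mul_laplaceOn α β (s / 2 + 3 / 2))))
  · obtain ⟨C, hC⟩ := exists_norm_iteratedFDeriv_refRemainder_le hχ α β (b := b) ha k N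
    exact ⟨C, 3, by norm_num, hC⟩
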